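/- **Setting.** Let $n\ge 1$, $D=\mathrm{diag}(d_1,\dots,d_n)$ with all $d_i>0$, and let $\mathcal M:\mathbb R\to\mathbb R^{n\times n}$ satisfy: - (H1) $\mathcal M$ is continuous and $\mathcal M(x)$ is symmetric for every $x$. - (H2) The limits $\mathcal M_\pm=\lim_{x\to\pm\infty}\mathcal M(x)$ exist, are negative definite, and each has distinct eigenvalues. - (H3) There are constants $C_M$ and $\eta_M>0$ with $\|\mathcal M(x)-\mathcal M_+\|\le C_Me^{-\eta_M|x|}$ for $x\ge 0$ and $\|\mathcal M(x)-\mathcal M_-\|\le C_Me^{-\eta_M|x|}$ for $x\le 0$. - (H4) $0$ is an eigenvalue of geometric and algebraic multiplicity one of $\mathcal L u=Du_{xx}+\mathcal M(x)u$ on $L^2(\mathbb R;\mathbb R^n)$ with domain $H^2(\mathbb R;\mathbb R^n)$. Norms are Euclidean norms and the induced operator norms. Consider $$U_x=\tilde{\mathcal A}(x)U,\qquad \tilde{\mathcal A}(x)=\begin{pmatrix}0&D^{-1}\\-\mathcal M(x)&0\end{pmatrix},\qquad \mathcal A_{+\infty}=\begin{pmatrix}0&D^{-1}\\-\mathcal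 M_+&0\end{pmatrix},\qquad \mathcal A_+(x)=\tilde{\mathcal A}(x)-\mathcal A_{+\infty}.$$ Let $\mathbb E^u_-(x)\subset\mathbb R^{2n}$ be the set of values at $x$ of the solutions on $\mathbb R$ that tend to $0$ as $x\to-\infty$, and let $\mathcal D=\{(u,w)\in\mathbb R^{2n}:u=0\}$. A conjugate point is an $s\in\mathbb R$ with $\mathbb E^u_-(s)\cap\mathcal D\ne\{0\}$. **Asymptotic system.** Let $z_1,\dots,z_n$ be an orthonormal basis of $\mathbb R^n$ with $D^{-1/2}\mathcal M_+D^{-1/2}z_j=-\nu_j^2z_j$, $\nu_j>0$, and put $\nu_{\max}=\max_j\nu_j$, $\nu_{\min}=\min_j\nu_j$, $d_{\max}=\max_i d_i$, $d_{\min}=\min_i d_i$, $$V_j^{u}=\frac1{\sqrt{2\nu_j}}\begin{pmatrix}D^{-1/2}z_j\\ \nu_jD^{1/2}z_j\end{pmatrix},\qquad V_j^{s}=\frac1{\sqrt{2\nu_j}}\begin{pmatrix}D^{-1/2}z_j\\-\nu_jD^{1/2}z_j\end{pmatrix}.$$ These are eigenvectors of $\mathcal A_{+\infty}$ with eigenvalues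 $\kappa=\nu_j$ and $\kappa=-\nu_j$. For an eigenvalue $\kappa$ let $P^{\ge\kappa}$ and $P^{<\kappa}$ be the spectral projections of $\mathcal A_{+\infty}$ belonging to the eigenvalues $\ge\kappa$ and $<\kappa$. Let $K_+>0$ and $\eta>0$ be constants with $\|e^{(\mathcal A_{+\infty}-\kappa)t}P^{\ge\kappa}\|\le K_+$ for $t\le0$ and $\|e^{(\mathcal A_{+\infty}-\kappa)t}P^{<\kappa}\|\le K_+e^{-\eta t}$ for $t\ge0$, for every eigenvalue $\kappa$. Let $L_+\ge0$. For each of the $2n$ eigenpairs $(\kappa,V)$ above let $W$ be a bounded continuous solution on $[L_+,\infty)$ of $$W(x)=V-\int_x^\infty e^{(\mathcal A_{+\infty}-\kappa)(x-y)}P^{\ge\kappa}\mathcal A_+(y)W(y)\,dy+\int_{L_+}^xe^{(\mathcal A_{+\infty}-\kappa)(x-y)}P^{<\kappa}\mathcal A_+(y)W(y)\,dy ,$$ and write $W_j^{u}$, $W_j^{s}$ for the functions so obtained from $V_j^u$, $V_j^s$. **Frame and coefficients.** Let $U_\varphi,U_1,\dots,U_{n-1}$ be solutions on $\mathbb R$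 whose values at each $x$ form a basis of $\mathbb E^u_-(x)$, with $U_\varphi(x)\to0$ as $x\to+\infty$ (so that $U_\varphi=(u,Du_x)$ with $u$ spanning $\ker\mathcal L$). Let $\tilde\Gamma=(\tilde\gamma_j^k)$ and $\tilde B=(\tilde\beta_j^k)$ in $\mathbb R^{n\times(n-1)}$ be the coefficient matrices in $$U_k(x)=\sum_{j=1}^n\big(\tilde\gamma_j^k e^{\nu_jx}W_j^u(x)+\tilde\beta_j^k e^{-\nu_jx}W_j^s(x)\big),\qquad x\ge L_+,\quad k=1,\dots,n-1.$$ **Constants.** Put $\lambda=\dfrac{K_+C_M}{\eta_M}e^{-\eta_ML_+}$ and $\epsilon_0=\dfrac{\lambda}{1-\lambda}\max_{j}\max(|V_j^{u}|,|V_j^{s}|)$. Let $\mu^*$ be the least eigenvalue of $\tilde\Gamma^T\tilde\Gamma$ and $\epsilon_b=\frac1{\sqrt{\mu^*}}e^{-2\nu_{\min}L_+}\|\tilde B\|$ (with $\epsilon_b=0$ if $n=1$). Put $$C_P=\frac{2\sqrt{2n\nu_{\max}d_{\max}}}{1-\epsilon_0\sqrt{2n\nu_{\max}d_{\max}}},\qquad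 C_Q=\sqrt{\frac{2n}{\nu_{\min}d_{\min}}}+\sqrt{2n\nu_{\max}d_{\max}}+2\epsilon_0n,$$ $$C_{M_1}=\epsilon_0C_Q(2+\epsilon_0C_Q),\qquad C_{M_2}=\epsilon_0C_P(2+\epsilon_0C_P)+2\epsilon_b(1+\epsilon_0C_P)+\epsilon_b^2 .$$ **Theorem.** Suppose that $L_+$ is so large that $\lambda<1$, $\epsilon_0\sqrt{2n\nu_{\max}d_{\max}}<1$, $C_{M_1}<1$, $C_{M_2}<1$ and $$2\epsilon_0(C_Q+C_P)+\epsilon_0^2(C_Q^2+C_P^2)+\epsilon_b^2+2\epsilon_b(1+\epsilon_0C_P)+(1+\epsilon_0C_Q)^2\frac{C_{M_1}}{1-C_{M_1}}+(1+\epsilon_0C_P+\epsilon_b)^2\frac{C_{M_2}}{1-C_{M_2}}<1 .$$ Then $\mathbb E^u_-(x)\cap\mathcal D=\{0\}$ for every $x\ge L_+$; that is, there are no conjugate points in $[L_+,\infty)$. -/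

import Mathlib

open Set Filter Topology MeasureTheory
open scoped ContDiff Matrix.Norms.L2Operator

noncomputable section

namespace ConjPt

/-- Euclidean `ℝⁿ`. -/
abbrev Vec (n : ℕ) : Type := EuclideanSpace ℝ (Fin n)

/-- Euclidean `ℝ²ⁿ`, written as `ℝⁿ × ℝⁿ ∋ (u, w)`. -/
abbrev Phase (n : ℕ) : Type := EuclideanSpace ℝ (Fin n ⊕ Fin n)

/-! ### The operator `L u = D u'' + M(x) u` on `L²(ℝ; ℝⁿ)` with domain `H²` -/

/-- `g` is the weak derivative of `f` on the real line. -/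
def IsWeakDeriv {n : ℕ} (f g : ℝ → Vec n) : Prop :=
  ∀ φ : ℝ → ℝ, ContDiff ℝ ∞ φ → HasCompactSupport φ →
    ∫ x, deriv φ x • f x = -∫ x, φ x • g x

/-- The real Hilbert space `L²(ℝ; ℝⁿ)`. -/
abbrev L2 (n : ℕ) : Type := Lp (Vec n) 2 (volume : Measure ℝ)

theorem integrable_smul_L2 {n : ℕ} {φ : ℝ → ℝ} (hc : Continuous φ) (hs : HasCompactSupport φ)
    (f : L2 n) : Integrable (fun x => φ x • f x) :=
  ((Lp.memLp f).locallyIntegrable (by norm_num)).integrable_smul_left_of_hasCompactSupport hc hs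

theorem IsWeakDeriv.add {n : ℕ} {f₁ g₁ f₂ g₂ : L2 n} (h₁ : IsWeakDeriv f₁ g₁)
    (h₂ : IsWeakDeriv f₂ g₂) : IsWeakDeriv ⇑(f₁ + f₂) ⇑(g₁ + g₂) := by
  intro φ hφ hs
  have hd : Continuous (deriv φ) := hφ.continuous_deriv (by simp)
  have e₁ : ∫ x, deriv φ x • (f₁ + f₂ : L2 n) x
      = ∫ x, (deriv φ x • f₁ x + deriv φ x • f₂ x) := by
    refine integral_congr_ae ?_
    filter_upwards [Lp.coeFn_add f₁ f₂] with x hx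
    rw [hx, Pi.add_apply, smul_add]
  have e₂ : ∫ x, φ x • (g₁ + g₂ : L2 n) x = ∫ x, (φ x • g₁ x + φ x • g₂ x) := by
    refine integral_congr_ae ?_
    filter_upwards [Lp.coeFn_add g₁ g₂] with x hx
    rw [hx, Pi.add_apply, smul_add]
  rw [e₁, e₂, integral_add (integrable_smul_L2 hd hs.deriv f₁) (integrable_smul_L2 hd hs.deriv f₂),
    integral_add (integrable_smul_L2 hφ.continuous hs g₁) (integrable_smul_L2 hφ.continuous hs g₂),
    h₁ φ hφ hs, h₂ φ hφ hs, neg_add]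

theorem IsWeakDeriv.smul {n : ℕ} {f g : L2 n} (c : ℝ) (h : IsWeakDeriv f g) :
    IsWeakDeriv ⇑(c • f) ⇑(c • g) := by
  intro φ hφ hs
  have e₁ : ∫ x, deriv φ x • (c • f : L2 n) x = ∫ x, c • (deriv φ x • f x) := by
    refine integral_congr_ae ?_
    filter_upwards [Lp.coeFn_smul c f] with x hx
    rw [hx, Pi.smul_apply, smul_comm]
  have e₂ : ∫ x, φ x • (c • g : L2 n) x = ∫ x, c • (φ x • g x) := by
    refine integral_congr_ae ?_
    filter_upwards [Lp.coeFn_smul c g] with x hx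
    rw [hx, Pi.smul_apply, smul_comm]
  rw [e₁, e₂, integral_smul, integral_smul, h φ hφ hs, smul_neg]

theorem isWeakDeriv_zero {n : ℕ} : IsWeakDeriv ⇑(0 : L2 n) ⇑(0 : L2 n) := by
  have h : ∀ ψ : ℝ → ℝ, ∫ x, ψ x • (0 : L2 n) x = 0 := by
    intro ψ
    refine integral_eq_zero_of_ae ?_
    filter_upwards [Lp.coeFn_zero (Vec n) 2 (volume : Measure ℝ)] with x hx
    rw [hx]; simp
  intro φ _ _
  rw [h, h, neg_zero]

/-- The graph of `L = D ∂ₓₓ + M(x)`, `D = diag d`, as an unbounded operator on `L²(ℝ; ℝⁿ)` with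
domain `H²(ℝ; ℝⁿ)`: the pairs `(u, f)` where `u` has weak derivatives `u' = v` and `u'' = w`
in `L²` and `f = D w + M u`. -/
def opGraph {n : ℕ} (d : Fin n → ℝ) (M : ℝ → Matrix (Fin n) (Fin n) ℝ) :
    Submodule ℝ (L2 n × L2 n) where
  carrier := {p | ∃ v w : L2 n, IsWeakDeriv p.1 v ∧ IsWeakDeriv v w ∧
    ∀ᵐ x, p.2 x = Matrix.toEuclideanLin (Matrix.diagonal d) (w x)
      + Matrix.toEuclideanLin (M x) (p.1 x)}
  add_mem' := by
    rintro ⟨u₁, f₁⟩ ⟨u₂, f₂⟩ ⟨v₁, w₁, a₁, b₁, c₁⟩ ⟨v₂, w₂, a₂, b₂, c₂⟩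
    refine ⟨v₁ + v₂, w₁ + w₂, a₁.add a₂, b₁.add b₂, ?_⟩
    filter_upwards [c₁, c₂, Lp.coeFn_add f₁ f₂, Lp.coeFn_add u₁ u₂, Lp.coeFn_add w₁ w₂]
      with x h₁ h₂ h₃ h₄ h₅
    simp only [Prod.mk_add_mk] at *
    rw [h₃, h₄, h₅, Pi.add_apply, Pi.add_apply, Pi.add_apply, h₁, h₂, map_add, map_add]
    abel
  zero_mem' := by
    refine ⟨0, 0, isWeakDeriv_zero, isWeakDeriv_zero, ?_⟩
    filter_upwards with x
    simp
  smul_mem' := by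
    rintro c ⟨u, f⟩ ⟨v, w, a, b, e⟩
    refine ⟨c • v, c • w, a.smul c, b.smul c, ?_⟩
    filter_upwards [e, Lp.coeFn_smul c f, Lp.coeFn_smul c u, Lp.coeFn_smul c w] with x h₁ h₂ h₃ h₄
    simp only [Prod.smul_mk] at *
    rw [h₂, h₃, h₄, Pi.smul_apply, Pi.smul_apply, Pi.smul_apply, h₁, map_smul, map_smul, smul_add]

/-- `ker Lᵏ` (with `u ∈ dom Lᵏ`): `ker L⁰ = 0`, and `u ∈ ker Lᵏ⁺¹` iff `u ∈ H²` and
`L u ∈ ker Lᵏ`. -/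
def kerPow {n : ℕ} (d : Fin n → ℝ) (M : ℝ → Matrix (Fin n) (Fin n) ℝ) : ℕ → Submodule ℝ (L2 n)
  | 0 => ⊥
  | k + 1 => (opGraph d M ⊓ (kerPow d M k).comap (LinearMap.snd ℝ (L2 n) (L2 n))).map
      (LinearMap.fst ℝ (L2 n) (L2 n))

/-- `λ = 0` is an eigenvalue of `L` of geometric and of algebraic multiplicity one. -/
def ZeroIsSimpleEigenvalue {n : ℕ} (d : Fin n → ℝ) (M : ℝ → Matrix (Fin n) (Fin n) ℝ) : Prop :=
  Module.finrank ℝ (kerPow d M 1) = 1 ∧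
    Module.finrank ℝ (⨆ k, kerPow d M k : Submodule ℝ (L2 n)) = 1

/-! ### The hypotheses on the potential -/

/-- `N` is (symmetric) negative definite with pairwise distinct eigenvalues. -/
structure IsNegDefDistinct {n : ℕ} (N : Matrix (Fin n) (Fin n) ℝ) : Prop where
  negDef : (-N).PosDef
  distinct : N.charpoly.roots.Nodup

/-- Hypotheses (H1)--(H4) for `D = diag d` and `M`, with limits `Mm`, `Mp` at `∓∞` and
constants `CM`, `ηM`. Matrix norms are Euclidean operator norms. -/
structure Hyp {n : ℕ} (d : Fin n → ℝ) (M : ℝ → Matrix (Fin n) (Fin n) ℝ)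
    (Mm Mp : Matrix (Fin n) (Fin n) ℝ) (CM ηM : ℝ) : Prop where
  d_pos : ∀ i, 0 < d i
  continuous : Continuous M
  symm : ∀ x, (M x).IsSymm
  tendsto_plus : Tendsto M atTop (𝓝 Mp)
  tendsto_minus : Tendsto M atBot (𝓝 Mm)
  plus : IsNegDefDistinct Mp
  minus : IsNegDefDistinct Mm
  ηM_pos : 0 < ηM
  bound_plus : ∀ x, 0 ≤ x → ‖M x - Mp‖ ≤ CM * Real.exp (-ηM * |x|)
  bound_minus : ∀ x, x ≤ 0 → ‖M x - Mm‖ ≤ CM * Real.exp (-ηM * |x|)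
  simple : ZeroIsSimpleEigenvalue d M

/-! ### The first-order system at `λ = 0`, the unstable subspace and conjugate points -/

/-- The matrix `[[0, D⁻¹], [-N, 0]]`. -/
def sysMatrix {n : ℕ} (d : Fin n → ℝ) (N : Matrix (Fin n) (Fin n) ℝ) :
    Matrix (Fin n ⊕ Fin n) (Fin n ⊕ Fin n) ℝ :=
  Matrix.fromBlocks 0 (Matrix.diagonal fun i => (d i)⁻¹) (-N) 0

/-- `U` solves `U' = [[0, D⁻¹], [-M(x), 0]] U` on all of `ℝ`. -/
def IsSolution {n : ℕ} (d : Fin n → ℝ) (M : ℝ → Matrix (Fin n) (Fin n) ℝ)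
    (U : ℝ → Phase n) : Prop :=
  ∀ x, HasDerivAt U (Matrix.toEuclideanLin (sysMatrix d (M x)) (U x)) x

/-- `E₋ᵘ(x)`: the values at `x` of the solutions that decay as `x → -∞`. -/
def unstableSubspace {n : ℕ} (d : Fin n → ℝ) (M : ℝ → Matrix (Fin n) (Fin n) ℝ) (x : ℝ) :
    Submodule ℝ (Phase n) where
  carrier := {v | ∃ U : ℝ → Phase n, IsSolution d M U ∧ Tendsto U atBot (𝓝 0) ∧ U x = v}
  add_mem' := by
    rintro _ _ ⟨U, hU, tU, rfl⟩ ⟨W, hW, tW, rfl⟩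
    refine ⟨U + W, fun y => ?_, ?_, rfl⟩
    · simpa using (hU y).add (hW y)
    · have h := tU.add tW
      rw [add_zero] at h
      exact h
  zero_mem' := ⟨0, fun y => by simpa using hasDerivAt_const y (0 : Phase n),
    tendsto_const_nhds, rfl⟩
  smul_mem' := by
    rintro c _ ⟨U, hU, tU, rfl⟩
    refine ⟨c • U, fun y => ?_, ?_, rfl⟩
    · simpa using (hU y).const_smul c
    · have h := tU.const_smul c
      rw [smul_zero] at h
      exact h

/-- The Dirichlet subspace `{(u, w) : u = 0}`. -/
def dirichlet (n : ℕ) : Submodule ℝ (Phase n) where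
  carrier := {v | ∀ i : Fin n, v (Sum.inl i) = 0}
  add_mem' := by
    intro a b ha hb i
    simp [ha i, hb i]
  zero_mem' := fun i => by simp
  smul_mem' := by
    intro c a ha i
    simp [ha i]

/-- `s` is a conjugate point: `E₋ᵘ(s)` meets the Dirichlet subspace nontrivially. -/
def IsConjugatePoint {n : ℕ} (d : Fin n → ℝ) (M : ℝ → Matrix (Fin n) (Fin n) ℝ) (s : ℝ) : Prop :=
  unstableSubspace d M s ⊓ dirichlet n ≠ ⊥

/-- `Uφ, U₁, …, Uₙ₋₁` is a frame of `E₋ᵘ`, made of solutions, whose first member `Uφ` also decays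
as `x → +∞` (so that it comes from an eigenfunction for the eigenvalue zero). -/
structure IsFrame {n : ℕ} (d : Fin n → ℝ) (M : ℝ → Matrix (Fin n) (Fin n) ℝ)
    (Uφ : ℝ → Phase n) (U : Fin (n - 1) → ℝ → Phase n) : Prop where
  sol_φ : IsSolution d M Uφ
  sol : ∀ k, IsSolution d M (U k)
  decay_φ : Tendsto Uφ atTop (𝓝 0)
  linearIndependent : ∀ x, LinearIndependent ℝ
    (fun o : Option (Fin (n - 1)) => o.elim (Uφ x) fun k => U k x)
  span : ∀ x, Submodule.span ℝ
    (range fun o : Option (Fin (n - 1)) => o.elim (Uφ x) fun k => U k x) = unstableSubspace d M x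

/-! ### The asymptotic system at `+∞` -/

/-- `z` is an orthonormal basis of eigenvectors of `D^{-1/2} M₊ D^{-1/2}`, with eigenvalues
`-νⱼ²`, `νⱼ > 0`. -/
structure IsSpectralData {n : ℕ} (d : Fin n → ℝ) (Mp : Matrix (Fin n) (Fin n) ℝ)
    (ν : Fin n → ℝ) (z : Fin n → Vec n) : Prop where
  ν_pos : ∀ j, 0 < ν j
  orthonormal : Orthonormal ℝ z
  eigen : ∀ j, Matrix.toEuclideanLin
    (Matrix.diagonal (fun i => (√(d i))⁻¹) * Mp * Matrix.diagonal (fun i => (√(d i))⁻¹)) (z j)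
      = -(ν j) ^ 2 • z j

/-- The eigenvalues of `A_{+∞}`: `νⱼ` (index `inl j`) and `-νⱼ` (index `inr j`). -/
def rate {n : ℕ} (ν : Fin n → ℝ) : Fin n ⊕ Fin n → ℝ :=
  Sum.elim ν (fun j => -ν j)

/-- The eigenvectors of `A_{+∞}`:
`Vⱼᵘ = (2νⱼ)^{-1/2} (D^{-1/2} zⱼ, νⱼ D^{1/2} zⱼ)` (index `inl j`) and
`Vⱼˢ = (2νⱼ)^{-1/2} (D^{-1/2} zⱼ, -νⱼ D^{1/2} zⱼ)` (index `inr j`). -/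
def eigVec {n : ℕ} (d : Fin n → ℝ) (ν : Fin n → ℝ) (z : Fin n → Vec n) :
    Fin n ⊕ Fin n → Phase n
  | Sum.inl j => (√(2 * ν j))⁻¹ • WithLp.toLp 2
      (Sum.elim (fun i => (√(d i))⁻¹ * z j i) (fun i => ν j * (√(d i) * z j i)))
  | Sum.inr j => (√(2 * ν j))⁻¹ • WithLp.toLp 2
      (Sum.elim (fun i => (√(d i))⁻¹ * z j i) (fun i => -ν j * (√(d i) * z j i)))

/-- The matrix whose columns are the eigenvectors of `A_{+∞}`. -/
def eigMatrix {n : ℕ} (d : Fin n → ℝ) (ν : Fin n → ℝ) (z : Fin n → Vec n) :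
    Matrix (Fin n ⊕ Fin n) (Fin n ⊕ Fin n) ℝ :=
  Matrix.of fun r c => eigVec d ν z c r

open Classical in
/-- The spectral projection of `A_{+∞}` onto the sum of the eigenspaces with eigenvalues in `S`,
along the other eigenspaces. -/
def spectralProj {n : ℕ} (d : Fin n → ℝ) (ν : Fin n → ℝ) (z : Fin n → Vec n) (S : Set ℝ) :
    Matrix (Fin n ⊕ Fin n) (Fin n ⊕ Fin n) ℝ :=
  eigMatrix d ν z * Matrix.diagonal (fun i => if rate ν i ∈ S then (1 : ℝ) else 0)
    * (eigMatrix d ν z)⁻¹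

/-- `e^{(A_{+∞} - κ) t} P_S`. -/
def evolution {n : ℕ} (d : Fin n → ℝ) (Mp : Matrix (Fin n) (Fin n) ℝ) (ν : Fin n → ℝ)
    (z : Fin n → Vec n) (κ : ℝ) (S : Set ℝ) (t : ℝ) : Matrix (Fin n ⊕ Fin n) (Fin n ⊕ Fin n) ℝ :=
  NormedSpace.exp (t • (sysMatrix d Mp - κ • (1 : Matrix (Fin n ⊕ Fin n) (Fin n ⊕ Fin n) ℝ)))
    * spectralProj d ν z S

/-- `K` is a constant in the exponential dichotomies of `A_{+∞} - κ`, for every eigenvalue `κ` of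
`A_{+∞}`: the part of the spectrum `≥ κ` is bounded by `K` in backward time, and the part `< κ`
decays exponentially in forward time with constant `K`. -/
def IsDichotomyConst {n : ℕ} (d : Fin n → ℝ) (Mp : Matrix (Fin n) (Fin n) ℝ) (ν : Fin n → ℝ)
    (z : Fin n → Vec n) (K : ℝ) : Prop :=
  0 < K ∧ ∃ η : ℝ, 0 < η ∧ ∀ i : Fin n ⊕ Fin n,
    (∀ t ≤ 0, ‖evolution d Mp ν z (rate ν i) (Ici (rate ν i)) t‖ ≤ K) ∧
    (∀ t ≥ 0, ‖evolution d Mp ν z (rate ν i) (Iio (rate ν i)) t‖ ≤ K * Real.exp (-η * t))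

/-- The integral operator on functions on `[L, ∞)` whose fixed point `W` gives the solution
`e^{κ x} W(x)`, asymptotic to `e^{κ x} V`, where `(κ, V)` is the `i`-th eigenpair of `A_{+∞}`:
`T(W)(x) = V - ∫_x^∞ e^{(A_{+∞}-κ)(x-y)} P^{≥κ} A₊(y) W(y) dy
  + ∫_L^x e^{(A_{+∞}-κ)(x-y)} P^{<κ} A₊(y) W(y) dy`,
with `A₊(y) = [[0, D⁻¹], [-M(y), 0]] - A_{+∞} = [[0, 0], [-M(y) + M₊, 0]]`. -/
def plusMap {n : ℕ} (d : Fin n → ℝ) (M : ℝ → Matrix (Fin n) (Fin n) ℝ)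
    (Mp : Matrix (Fin n) (Fin n) ℝ) (ν : Fin n → ℝ) (z : Fin n → Vec n) (L : ℝ)
    (i : Fin n ⊕ Fin n) (W : ℝ → Phase n) (x : ℝ) : Phase n :=
  eigVec d ν z i
    - (∫ y in Ioi x, Matrix.toEuclideanLin
        (evolution d Mp ν z (rate ν i) (Ici (rate ν i)) (x - y)
          * (sysMatrix d (M y) - sysMatrix d Mp)) (W y))
    + ∫ y in L..x, Matrix.toEuclideanLin
        (evolution d Mp ν z (rate ν i) (Iio (rate ν i)) (x - y)
          * (sysMatrix d (M y) - sysMatrix d Mp)) (W y)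

/-- The functions `Wᵢ` (`Wⱼ^{+,u}` for `i = inl j`, `Wⱼ^{+,s}` for `i = inr j`) are the bounded
continuous fixed points on `[L, ∞)` of the integral operators above. -/
def IsAsymptoticFamily {n : ℕ} (d : Fin n → ℝ) (M : ℝ → Matrix (Fin n) (Fin n) ℝ)
    (Mp : Matrix (Fin n) (Fin n) ℝ) (ν : Fin n → ℝ) (z : Fin n → Vec n) (L : ℝ)
    (W : Fin n ⊕ Fin n → ℝ → Phase n) : Prop :=
  ∀ i, ContinuousOn (W i) (Ici L) ∧ (∃ C : ℝ, ∀ x ≥ L, ‖W i x‖ ≤ C) ∧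
    ∀ x ≥ L, W i x = plusMap d M Mp ν z L i (W i) x

/-- `Γt` and `Bt` are the matrices of coefficients (column `k` belongs to `Uₖ`) in
`Uₖ(x) = ∑ⱼ (Γtⱼₖ e^{νⱼ x} Wⱼᵘ(x) + Btⱼₖ e^{-νⱼ x} Wⱼˢ(x))`, `x ≥ L`. -/
def IsCoeff {n : ℕ} (ν : Fin n → ℝ) (L : ℝ) (W : Fin n ⊕ Fin n → ℝ → Phase n)
    (U : Fin (n - 1) → ℝ → Phase n) (Γt Bt : Matrix (Fin n) (Fin (n - 1)) ℝ) : Prop :=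
  ∀ k, ∀ x ≥ L, U k x = ∑ j, (Γt j k • Real.exp (ν j * x) • W (Sum.inl j) x
    + Bt j k • Real.exp (-ν j * x) • W (Sum.inr j) x)

/-! ### The constants -/

/-- `λ_{T₊} = K C_M / η_M · e^{-η_M L}`. -/
def contractionConst (K CM ηM L : ℝ) : ℝ :=
  K * CM / ηM * Real.exp (-ηM * L)

/-- `ε₀ = λ / (1 - λ) · max |Vⱼ^{+,s/u}|`, with `λ = λ_{T₊}`. -/
def eps0 {n : ℕ} (d : Fin n → ℝ) (ν : Fin n → ℝ) (z : Fin n → Vec n) (lam : ℝ) : ℝ :=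
  lam / (1 - lam) * ⨆ i, ‖eigVec d ν z i‖

/-- `μ*`, the least eigenvalue of `Γtᵀ Γt`. -/
def muStar {n : ℕ} (Γt : Matrix (Fin n) (Fin (n - 1)) ℝ) : ℝ :=
  sInf (spectrum ℝ (Γt.transpose * Γt))

/-- `ε_b = (μ*)^{-1/2} e^{-2 ν_min L} ‖Bt‖`. For `n = 1`, where `Γt` and `Bt` have no columns,
this is `0`. -/
def epsB {n : ℕ} (ν : Fin n → ℝ) (L : ℝ) (Γt Bt : Matrix (Fin n) (Fin (n - 1)) ℝ) : ℝ :=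
  1 / √(muStar Γt) * Real.exp (-2 * (⨅ j, ν j) * L) * ‖Bt‖

/-- `√(2 n ν_max d_max)`. -/
def sigma {n : ℕ} (d ν : Fin n → ℝ) : ℝ :=
  √(2 * n * (⨆ j, ν j) * ⨆ i, d i)

/-- `C_P`. -/
def constP {n : ℕ} (d ν : Fin n → ℝ) (e : ℝ) : ℝ :=
  2 * sigma d ν / (1 - e * sigma d ν)

/-- `C_Q`. -/
def constQ {n : ℕ} (d ν : Fin n → ℝ) (e : ℝ) : ℝ :=
  √(2 * n / ((⨅ j, ν j) * ⨅ i, d i)) + sigma d ν + 2 * e * n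

/-- `C_{M₁}`. -/
def constM1 {n : ℕ} (d ν : Fin n → ℝ) (e : ℝ) : ℝ :=
  e * constQ d ν e * (2 + e * constQ d ν e)

/-- `C_{M₂}`. -/
def constM2 {n : ℕ} (d ν : Fin n → ℝ) (e b : ℝ) : ℝ :=
  e * constP d ν e * (2 + e * constP d ν e) + 2 * b * (1 + e * constP d ν e) + b ^ 2

/-- The explicit bound, as a function of `e = ε₀` and `b = ε_b`. -/
def projectionBound {n : ℕ} (d ν : Fin n → ℝ) (e b : ℝ) : ℝ :=
  2 * e * (constQ d ν e + constP d ν e) + e ^ 2 * (constQ d ν e ^ 2 + constP d ν e ^ 2)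
    + b ^ 2 + 2 * b * (1 + e * constP d ν e)
    + (1 + e * constQ d ν e) ^ 2 * (constM1 d ν e / (1 - constM1 d ν e))
    + (1 + e * constP d ν e + b) ^ 2 * (constM2 d ν e b / (1 - constM2 d ν e b))

/-- `L_+ = L` is large enough: `λ_{T₊} < 1`, the conditions under which the explicit bound is
valid hold, and the explicit bound is less than one. -/
structure LargeEnough {n : ℕ} (d ν : Fin n → ℝ) (lam e b : ℝ) : Prop where
  lam_lt : lam < 1
  sigma_lt : e * sigma d ν < 1
  constM1_lt : constM1 d ν e < 1
  constM2_lt : constM2 d ν e b < 1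
  bound_lt : projectionBound d ν e b < 1

end ConjPt

end

open ConjPt

/-! The proof is symplectic. By symmetry of `M x`, the form `omega` of two solutions is constant,
hence zero when both decay at the same end. Decay at `-∞` gives `omega (Uφ x) (U k x) = 0`; decay at
`+∞` makes the `W (Sum.inr j) x` pairwise orthogonal and orthogonal to `Uφ x`. They are close to the
stable eigenvectors, so they span a Lagrangian space, and `Uφ x` is a combination of them with some
coefficient vector `f` (`exists_eq_sum_of_omega_eq_zero`).

A vector of the unstable subspace is therefore `∑ g j • Wᵘ j + ∑ (t • f + r) j • Wˢ j`. Here `g`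
comes from `Γt` and `r` from `Bt`. Simplicity of the eigenvalue zero makes `Γt` injective, so that
`‖r‖ ≤ ε_b ‖g‖` (`norm_weighted_le`).

In the symplectic basis of eigenvectors, with `X = ε₀ C_Q` and `s = t • f + r`, the Dirichlet
condition reads `g + s = O(X)`, while orthogonality of `Uφ` to the `U k` reads `⟪t • f, g⟫ = O(X)`.
Thus `g` and `s` are almost opposite and almost orthogonal. Expanding `‖g + s‖ ^ 2` then forces `g =
s = 0` (`eq_zero_of_mem_dirichlet`) once an inequality in `X` and `ε_b` holds, which the explicit
bound implies (`LargeEnough.small`). -/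

noncomputable section
namespace ConjPt

/-! ### The symplectic form -/

/-- The standard symplectic form on `ℝ²ⁿ`. -/
def omega {n : ℕ} : Phase n →ₗ[ℝ] Phase n →ₗ[ℝ] ℝ :=
  LinearMap.mk₂ ℝ (fun p q => ∑ i, (p (Sum.inl i) * q (Sum.inr i) - p (Sum.inr i) * q (Sum.inl i)))
    (fun p p' q => by
      rw [← Finset.sum_add_distrib]; exact Finset.sum_congr rfl fun i _ => by simp; ring)
    (fun c p q => by
      rw [smul_eq_mul, Finset.mul_sum]; exact Finset.sum_congr rfl fun i _ => by simp; ring)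
    (fun p q q' => by
      rw [← Finset.sum_add_distrib]; exact Finset.sum_congr rfl fun i _ => by simp; ring)
    (fun c p q => by
      rw [smul_eq_mul, Finset.mul_sum]; exact Finset.sum_congr rfl fun i _ => by simp; ring)

theorem omega_apply {n : ℕ} (p q : Phase n) :
    omega p q = ∑ i, (p (Sum.inl i) * q (Sum.inr i) - p (Sum.inr i) * q (Sum.inl i)) := rfl

theorem omega_swap {n : ℕ} (p q : Phase n) : omega q p = -omega p q := by
  rw [omega_apply, omega_apply, ← Finset.sum_neg_distrib]
  exact Finset.sum_congr rfl fun i _ => by ring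

theorem norm_sq_phase {n : ℕ} (p : Phase n) :
    ‖p‖ ^ 2 = ∑ i, p (Sum.inl i) ^ 2 + ∑ i, p (Sum.inr i) ^ 2 := by
  rw [EuclideanSpace.real_norm_sq_eq, Fintype.sum_sum_type]

/-- Pairing with `q` is the inner product with a rotated copy of `q` of equal norm, so
Cauchy–Schwarz applies. -/
theorem abs_omega_le {n : ℕ} (p q : Phase n) : |omega p q| ≤ ‖p‖ * ‖q‖ := by
  refine abs_le_of_sq_le_sq ?_ (by positivity)
  let J : Phase n := WithLp.toLp 2 (Sum.elim (fun i => q (Sum.inr i)) (fun i => -q (Sum.inl i)))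
  have h1 : omega p q = inner ℝ J p := by
    rw [omega_apply, PiLp.inner_apply, Fintype.sum_sum_type, ← Finset.sum_add_distrib]
    exact Finset.sum_congr rfl fun i _ => by simp [J]; ring
  have h2 : ‖J‖ ^ 2 = ‖q‖ ^ 2 := by
    rw [norm_sq_phase, norm_sq_phase, add_comm]
    simp [J]
  have h3 := abs_real_inner_le_norm J p
  calc omega p q ^ 2 = |inner ℝ J p| ^ 2 := by rw [h1, sq_abs]
    _ ≤ (‖J‖ * ‖p‖) ^ 2 := by gcongr
    _ = _ := by rw [mul_pow, h2]; ring

theorem omega_of_mem_dirichlet {n : ℕ} {p q : Phase n} (hp : p ∈ dirichlet n)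
    (hq : q ∈ dirichlet n) : omega p q = 0 := by
  rw [omega_apply]
  exact Finset.sum_eq_zero fun i _ => by rw [hp i, hq i]; simp

/-! ### The symplectic eigenbasis of the asymptotic matrix -/

section spectral
variable {n : ℕ} {d : Fin n → ℝ} {Mp : Matrix (Fin n) (Fin n) ℝ} {ν : Fin n → ℝ} {z : Fin n → Vec n}

theorem orthonormal_sum (hz : IsSpectralData d Mp ν z) (i j : Fin n) :
    ∑ k, z i k * z j k = if i = j then 1 else 0 := by
  have h := orthonormal_iff_ite.1 hz.orthonormal j i
  rw [PiLp.inner_apply] at h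
  simp only [eq_comm (a := j)] at h
  rw [← h]
  exact Finset.sum_congr rfl fun k _ => by simp

/-- The weights `D^{±1/2}` cancel in each product, leaving `(νᵢ + νⱼ) ⟪zᵢ, zⱼ⟫`. The factor
`(2νⱼ)^{-1/2}` in the eigenvectors is what normalizes the pairing to one. -/
theorem omega_inr_inl (hd : ∀ i, 0 < d i) (hz : IsSpectralData d Mp ν z) (i j : Fin n) :
    omega (eigVec d ν z (Sum.inr i)) (eigVec d ν z (Sum.inl j)) = if i = j then 1 else 0 := by
  have e : omega (eigVec d ν z (Sum.inr i)) (eigVec d ν z (Sum.inl j))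
      = (√(2 * ν i))⁻¹ * (√(2 * ν j))⁻¹ * (ν i + ν j) * ∑ k, z i k * z j k := by
    rw [omega_apply, Finset.mul_sum]
    refine Finset.sum_congr rfl fun k _ => ?_
    have := (Real.sqrt_pos.2 (hd k)).ne'
    simp [eigVec]
    field_simp
    ring
  rw [e, orthonormal_sum hz]
  split_ifs with h
  · subst h
    have h1 : 0 < 2 * ν i := by linarith [hz.ν_pos i]
    rw [mul_one, ← mul_inv, Real.mul_self_sqrt h1.le, ← two_mul, inv_mul_cancel₀ h1.ne']
  · simp

theorem omega_inl_inl (hd : ∀ i, 0 < d i) (hz : IsSpectralData d Mp ν z) (i j : Fin n) :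
    omega (eigVec d ν z (Sum.inl i)) (eigVec d ν z (Sum.inl j)) = 0 := by
  have e : omega (eigVec d ν z (Sum.inl i)) (eigVec d ν z (Sum.inl j))
      = (√(2 * ν i))⁻¹ * (√(2 * ν j))⁻¹ * (ν j - ν i) * ∑ k, z i k * z j k := by
    rw [omega_apply, Finset.mul_sum]
    refine Finset.sum_congr rfl fun k _ => ?_
    have := (Real.sqrt_pos.2 (hd k)).ne'
    simp [eigVec]
    field_simp
  rw [e, orthonormal_sum hz]
  split_ifs with h
  · subst h; simp
  · simp

theorem omega_inr_inr (hd : ∀ i, 0 < d i) (hz : IsSpectralData d Mp ν z) (i j : Fin n) :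
    omega (eigVec d ν z (Sum.inr i)) (eigVec d ν z (Sum.inr j)) = 0 := by
  have e : omega (eigVec d ν z (Sum.inr i)) (eigVec d ν z (Sum.inr j))
      = (√(2 * ν i))⁻¹ * (√(2 * ν j))⁻¹ * (ν i - ν j) * ∑ k, z i k * z j k := by
    rw [omega_apply, Finset.mul_sum]
    refine Finset.sum_congr rfl fun k _ => ?_
    have := (Real.sqrt_pos.2 (hd k)).ne'
    simp [eigVec]
    field_simp
    ring
  rw [e, orthonormal_sum hz]
  split_ifs with h
  · subst h; simp
  · simp

/-- The rows of this matrix are the symplectic duals of the eigenvectors of `A_{+∞}`. -/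
def dualMatrix {n : ℕ} (d : Fin n → ℝ) (ν : Fin n → ℝ) (z : Fin n → Vec n) :
    Matrix (Fin n ⊕ Fin n) (Fin n ⊕ Fin n) ℝ :=
  Matrix.of fun r c => Sum.elim
    (fun j => omega (eigVec d ν z (Sum.inr j)) (EuclideanSpace.single c 1))
    (fun j => -omega (eigVec d ν z (Sum.inl j)) (EuclideanSpace.single c 1)) r

theorem dualMatrix_mulVec_inl (v : Phase n) (j : Fin n) :
    (dualMatrix d ν z).mulVec v (Sum.inl j) = omega (eigVec d ν z (Sum.inr j)) v := by
  simp [dualMatrix, Matrix.mulVec, dotProduct, omega_apply]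
  ring

theorem dualMatrix_mulVec_inr (v : Phase n) (j : Fin n) :
    (dualMatrix d ν z).mulVec v (Sum.inr j) = -omega (eigVec d ν z (Sum.inl j)) v := by
  simp [dualMatrix, Matrix.mulVec, dotProduct, omega_apply]
  ring

theorem dualMatrix_mul_eigMatrix (hd : ∀ i, 0 < d i) (hz : IsSpectralData d Mp ν z) :
    dualMatrix d ν z * eigMatrix d ν z = 1 := by
  ext r c
  have h : (dualMatrix d ν z * eigMatrix d ν z) r c
      = (dualMatrix d ν z).mulVec (eigVec d ν z c) r := rfl
  rw [h]
  rcases r with i | i <;> rcases c with j | j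
  · rw [dualMatrix_mulVec_inl, omega_inr_inl hd hz]; simp [Matrix.one_apply]
  · rw [dualMatrix_mulVec_inl, omega_inr_inr hd hz]; simp
  · rw [dualMatrix_mulVec_inr, omega_inl_inl hd hz]; simp
  · rw [dualMatrix_mulVec_inr, ← omega_swap, omega_inr_inl hd hz]
    simp [Matrix.one_apply, eq_comm]

theorem eigMatrix_mul_dualMatrix (hd : ∀ i, 0 < d i) (hz : IsSpectralData d Mp ν z) :
    eigMatrix d ν z * dualMatrix d ν z = 1 :=
  mul_eq_one_comm.1 (dualMatrix_mul_eigMatrix hd hz)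

theorem isUnit_det_eigMatrix (hd : ∀ i, 0 < d i) (hz : IsSpectralData d Mp ν z) :
    IsUnit (eigMatrix d ν z).det :=
  Matrix.isUnit_det_of_left_inverse (dualMatrix_mul_eigMatrix hd hz)

theorem spectralProj_add (hd : ∀ i, 0 < d i) (hz : IsSpectralData d Mp ν z) (κ : ℝ) :
    spectralProj d ν z (Ici κ) + spectralProj d ν z (Iio κ) = 1 := by
  have key : ∀ f g : Fin n ⊕ Fin n → ℝ, (∀ i, f i + g i = 1) →
      eigMatrix d ν z * Matrix.diagonal f * (eigMatrix d ν z)⁻¹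
        + eigMatrix d ν z * Matrix.diagonal g * (eigMatrix d ν z)⁻¹ = 1 := by
    intro f g h
    rw [← add_mul, ← mul_add, Matrix.diagonal_add, funext h, Matrix.diagonal_one, mul_one,
      Matrix.mul_nonsing_inv _ (isUnit_det_eigMatrix hd hz)]
  refine key _ _ fun i => ?_
  by_cases h : κ ≤ rate ν i
  · simp [h]
  · simp [h, not_le.1 h]

/-- Expansion of a vector in the eigenvectors of `A_{+∞}`. -/
theorem eigVec_expansion (hd : ∀ i, 0 < d i) (hz : IsSpectralData d Mp ν z) (y : Phase n) :
    y = ∑ j, omega (eigVec d ν z (Sum.inr j)) y • eigVec d ν z (Sum.inl j)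
      + ∑ j, (-omega (eigVec d ν z (Sum.inl j)) y) • eigVec d ν z (Sum.inr j) := by
  have h : (eigMatrix d ν z).mulVec ((dualMatrix d ν z).mulVec y) = y := by
    rw [Matrix.mulVec_mulVec, eigMatrix_mul_dualMatrix hd hz, Matrix.one_mulVec]
  ext r
  rw [← congrFun h r]
  have : (eigMatrix d ν z).mulVec ((dualMatrix d ν z).mulVec y) r
      = ∑ c, eigVec d ν z c r * (dualMatrix d ν z).mulVec y c := rfl
  rw [this, Fintype.sum_sum_type]
  simp only [dualMatrix_mulVec_inl, dualMatrix_mulVec_inr, PiLp.add_apply, WithLp.ofLp_sum,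
    Finset.sum_apply, PiLp.smul_apply, smul_eq_mul]
  congr 1 <;> exact Finset.sum_congr rfl fun j _ => by ring

theorem sysMatrix_apply_inl (N : Matrix (Fin n) (Fin n) ℝ) (v : Phase n) (i : Fin n) :
    Matrix.toEuclideanLin (sysMatrix d N) v (Sum.inl i) = (d i)⁻¹ * v (Sum.inr i) := by
  simp [sysMatrix, Matrix.toEuclideanLin, Matrix.mulVec, dotProduct, Matrix.diagonal_apply]

theorem sysMatrix_apply_inr (N : Matrix (Fin n) (Fin n) ℝ) (v : Phase n) (i : Fin n) :
    Matrix.toEuclideanLin (sysMatrix d N) v (Sum.inr i) = -∑ j, N i j * v (Sum.inl j) := by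
  simp [sysMatrix, Matrix.toEuclideanLin, Matrix.mulVec, dotProduct]

theorem sysMatrix_eigVec (hd : ∀ i, 0 < d i) (hz : IsSpectralData d Mp ν z) (i : Fin n ⊕ Fin n) :
    Matrix.toEuclideanLin (sysMatrix d Mp) (eigVec d ν z i) = rate ν i • eigVec d ν z i := by
  -- The eigenvalue equation for `z j`, multiplied by `D^{1/2}`.
  have key : ∀ j k, ∑ l, Mp k l * ((√(d l))⁻¹ * z j l) = -(ν j) ^ 2 * (√(d k) * z j k) := by
    intro j k
    have h := congrArg (fun v : Vec n => v k) (hz.eigen j)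
    simp [Matrix.toEuclideanLin, Matrix.mulVec, dotProduct, Matrix.mul_apply,
      Matrix.diagonal_apply] at h
    have hk := (Real.sqrt_pos.2 (hd k)).ne'
    have h2 : ∑ l, Mp k l * ((√(d l))⁻¹ * z j l)
        = √(d k) * ∑ l, (√(d k))⁻¹ * Mp k l * (√(d l))⁻¹ * z j l := by
      rw [Finset.mul_sum]
      exact Finset.sum_congr rfl fun l _ => by field_simp
    rw [h2]
    simp only [mul_assoc, ← Finset.mul_sum] at h ⊢
    rw [h]
    ring
  ext r
  rcases i with j | j <;> rcases r with k | k
  · have hk := Real.sqrt_pos.2 (hd k)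
    rw [sysMatrix_apply_inl]
    simp [eigVec, rate]
    nth_rewrite 1 [← Real.sq_sqrt (hd k).le]
    field_simp
  · rw [sysMatrix_apply_inr]
    simp [eigVec, rate]
    have := key j k
    rw [show ∀ c : ℝ, (∑ x, Mp k x * (c * ((√(d x))⁻¹ * z j x)))
      = c * ∑ l, Mp k l * ((√(d l))⁻¹ * z j l) from fun c => by
        rw [Finset.mul_sum]; exact Finset.sum_congr rfl fun l _ => by ring, this]
    ring
  · have hk := Real.sqrt_pos.2 (hd k)
    rw [sysMatrix_apply_inl]
    simp [eigVec, rate]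
    nth_rewrite 1 [← Real.sq_sqrt (hd k).le]
    field_simp
  · rw [sysMatrix_apply_inr]
    simp [eigVec, rate]
    have := key j k
    rw [show ∀ c : ℝ, (∑ x, Mp k x * (c * ((√(d x))⁻¹ * z j x)))
      = c * ∑ l, Mp k l * ((√(d l))⁻¹ * z j l) from fun c => by
        rw [Finset.mul_sum]; exact Finset.sum_congr rfl fun l _ => by ring, this]
    ring

/-- Bessel's inequality for `z` with positive weights. -/
theorem sum_sq_inner_le (hz : IsSpectralData d Mp ν z) (a : Fin n → ℝ) :
    ∑ j, (∑ k, z j k * a k) ^ 2 ≤ ∑ k, a k ^ 2 := by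
  have h := hz.orthonormal.sum_inner_products_le (x := (WithLp.toLp 2 a : Vec n))
    (s := Finset.univ)
  rw [EuclideanSpace.real_norm_sq_eq] at h
  refine le_trans (le_of_eq (Finset.sum_congr rfl fun j _ => ?_)) h
  rw [Real.norm_eq_abs, sq_abs, PiLp.inner_apply]
  congr 1
  exact Finset.sum_congr rfl fun k _ => by simp [mul_comm]

theorem sigma_nonneg : 0 ≤ sigma d ν := Real.sqrt_nonneg _

/-- The signs `s = 1` and `s = -1` give, up to an overall sign, the coordinates of `y` along the
unstable and the stable eigenvectors. The factor `n` is included to absorb the `√n` lost when `n`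
perturbed vectors are summed. -/
theorem sum_sq_dual_le (hn : 1 ≤ n) (hd : ∀ i, 0 < d i) (hz : IsSpectralData d Mp ν z)
    (y : Phase n) (s : ℝ) (hs : s ^ 2 = 1) (e : ℝ) (he : 0 ≤ e) :
    n * ∑ j, ((√(2 * ν j))⁻¹ * (∑ k, z j k * ((√(d k))⁻¹ * y (Sum.inr k))
      + s * ν j * ∑ k, z j k * (√(d k) * y (Sum.inl k)))) ^ 2 ≤ constQ d ν e ^ 2 * ‖y‖ ^ 2 := by
  have : Nonempty (Fin n) := ⟨⟨0, hn⟩⟩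
  set νm := ⨅ j, ν j
  set νM := ⨆ j, ν j
  set dm := ⨅ j, d j
  set dM := ⨆ j, d j
  have h1 : ∀ j, νm ≤ ν j := fun j => ciInf_le (Set.finite_range _).bddBelow j
  have h2 : ∀ j, ν j ≤ νM := fun j => le_ciSup (Set.finite_range _).bddAbove j
  have h3 : ∀ j, dm ≤ d j := fun j => ciInf_le (Set.finite_range _).bddBelow j
  have h4 : ∀ j, d j ≤ dM := fun j => le_ciSup (Set.finite_range _).bddAbove j
  have p1 : 0 < νm := by
    obtain ⟨j, hj⟩ := exists_eq_ciInf_of_finite (f := ν)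
    exact (hz.ν_pos j).trans_eq hj
  have p3 : 0 < dm := by
    obtain ⟨j, hj⟩ := exists_eq_ciInf_of_finite (f := d)
    exact (hd j).trans_eq hj
  have p2 : 0 < νM := p1.trans_le ((h1 ⟨0, hn⟩).trans (h2 _))
  have p4 : 0 < dM := p3.trans_le ((h3 ⟨0, hn⟩).trans (h4 _))
  have b1 : ∑ j, (∑ k, z j k * ((√(d k))⁻¹ * y (Sum.inr k))) ^ 2
      ≤ dm⁻¹ * ∑ k, y (Sum.inr k) ^ 2 := by
    refine (sum_sq_inner_le hz _).trans ?_
    rw [Finset.mul_sum]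
    refine Finset.sum_le_sum fun k _ => ?_
    rw [mul_pow, inv_pow, Real.sq_sqrt (hd k).le]
    have := h3 k
    gcongr
  have b2 : ∑ j, (∑ k, z j k * (√(d k) * y (Sum.inl k))) ^ 2
      ≤ dM * ∑ k, y (Sum.inl k) ^ 2 := by
    refine (sum_sq_inner_le hz _).trans ?_
    rw [Finset.mul_sum]
    refine Finset.sum_le_sum fun k _ => ?_
    rw [mul_pow, Real.sq_sqrt (hd k).le]
    have := h4 k
    gcongr
  have b3 : ∑ j, ((√(2 * ν j))⁻¹ * (∑ k, z j k * ((√(d k))⁻¹ * y (Sum.inr k))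
      + s * ν j * ∑ k, z j k * (√(d k) * y (Sum.inl k)))) ^ 2
      ≤ νm⁻¹ * ∑ j, (∑ k, z j k * ((√(d k))⁻¹ * y (Sum.inr k))) ^ 2
        + νM * ∑ j, (∑ k, z j k * (√(d k) * y (Sum.inl k))) ^ 2 := by
    rw [Finset.mul_sum, Finset.mul_sum, ← Finset.sum_add_distrib]
    refine Finset.sum_le_sum fun j _ => ?_
    set a := ∑ k, z j k * ((√(d k))⁻¹ * y (Sum.inr k))
    set b := ∑ k, z j k * (√(d k) * y (Sum.inl k))
    have hν := hz.ν_pos j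
    rw [mul_pow, inv_pow, Real.sq_sqrt (by linarith)]
    -- The defect is again a square, by the parallelogram identity.
    have i1 : (2 * ν j)⁻¹ * (a + s * ν j * b) ^ 2 ≤ (ν j)⁻¹ * a ^ 2 + ν j * b ^ 2 := by
      have : (ν j)⁻¹ * a ^ 2 + ν j * b ^ 2 - (2 * ν j)⁻¹ * (a + s * ν j * b) ^ 2
          = (2 * ν j)⁻¹ * (a - s * ν j * b) ^ 2 := by
        field_simp
        linear_combination (-2 * ν j ^ 2 * b ^ 2) * hs
      have : 0 ≤ (2 * ν j)⁻¹ * (a - s * ν j * b) ^ 2 := by positivity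
      linarith
    refine i1.trans ?_
    have := h1 j
    have := h2 j
    gcongr
  set A := ∑ k, y (Sum.inr k) ^ 2
  set C := ∑ k, y (Sum.inl k) ^ 2
  have hA : 0 ≤ A := Finset.sum_nonneg fun _ _ => sq_nonneg _
  have hC : 0 ≤ C := Finset.sum_nonneg fun _ _ => sq_nonneg _
  have b4 : νm⁻¹ * ∑ j, (∑ k, z j k * ((√(d k))⁻¹ * y (Sum.inr k))) ^ 2
        + νM * ∑ j, (∑ k, z j k * (√(d k) * y (Sum.inl k))) ^ 2
      ≤ νm⁻¹ * (dm⁻¹ * A) + νM * (dM * C) := by gcongr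
  have hy : ‖y‖ ^ 2 = C + A := norm_sq_phase y
  have hσ : sigma d ν ^ 2 = 2 * n * νM * dM := Real.sq_sqrt (by positivity)
  have hτ : √(2 * n / (νm * dm)) ^ 2 = 2 * n / (νm * dm) := Real.sq_sqrt (by positivity)
  have hQ : constQ d ν e = √(2 * n / (νm * dm)) + sigma d ν + 2 * e * n := rfl
  have τ0 : 0 ≤ √(2 * n / (νm * dm)) := Real.sqrt_nonneg _
  have σ0 : 0 ≤ sigma d ν := sigma_nonneg
  have en : 0 ≤ 2 * e * n := by positivity
  -- All three summands of `C_Q` are nonnegative, so its square dominates the square of each.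
  have q1 : 2 * n / (νm * dm) ≤ constQ d ν e ^ 2 := by
    rw [← hτ, hQ]; gcongr; linarith
  have q2 : 2 * n * νM * dM ≤ constQ d ν e ^ 2 := by
    rw [← hσ, hQ]; gcongr; linarith
  calc _ ≤ n * (νm⁻¹ * (dm⁻¹ * A) + νM * (dM * C)) := by
        gcongr; exact b3.trans b4
    _ = (2 * n / (νm * dm) * A + 2 * n * νM * dM * C) / 2 := by field_simp
    _ ≤ (constQ d ν e ^ 2 * A + constQ d ν e ^ 2 * C) / 2 := by gcongr
    _ ≤ constQ d ν e ^ 2 * ‖y‖ ^ 2 := by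
        rw [hy]
        have : 0 ≤ constQ d ν e ^ 2 * (A + C) := by positivity
        linarith

/-- The coordinates of `y` along the `Vⱼᵘ`. -/
def coordU {n : ℕ} (d ν : Fin n → ℝ) (z : Fin n → Vec n) (y : Phase n) : Vec n :=
  WithLp.toLp 2 fun j => omega (eigVec d ν z (Sum.inr j)) y

/-- The coordinates of `y` along the `Vⱼˢ`. -/
def coordS {n : ℕ} (d ν : Fin n → ℝ) (z : Fin n → Vec n) (y : Phase n) : Vec n :=
  WithLp.toLp 2 fun j => -omega (eigVec d ν z (Sum.inl j)) y

theorem constQ_nonneg {e : ℝ} (he : 0 ≤ e) : 0 ≤ constQ d ν e := by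
  have := sigma_nonneg (d := d) (ν := ν)
  unfold constQ
  positivity

theorem norm_coordU_le (hn : 1 ≤ n) (hd : ∀ i, 0 < d i) (hz : IsSpectralData d Mp ν z)
    {e : ℝ} (he : 0 ≤ e) (y : Phase n) : √n * ‖coordU d ν z y‖ ≤ constQ d ν e * ‖y‖ := by
  refine le_of_sq_le_sq ?_ (mul_nonneg (constQ_nonneg he) (norm_nonneg _))
  rw [mul_pow, mul_pow, Real.sq_sqrt (by positivity), EuclideanSpace.real_norm_sq_eq]
  refine le_trans (le_of_eq ?_) (sum_sq_dual_le hn hd hz y 1 (by norm_num) e he)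
  congr 1
  refine Finset.sum_congr rfl fun j _ => ?_
  congr 1
  simp only [coordU, omega_apply, Finset.mul_sum, mul_add, ← Finset.sum_add_distrib]
  exact Finset.sum_congr rfl fun k _ => by simp [eigVec]; ring

theorem norm_coordS_le (hn : 1 ≤ n) (hd : ∀ i, 0 < d i) (hz : IsSpectralData d Mp ν z)
    {e : ℝ} (he : 0 ≤ e) (y : Phase n) : √n * ‖coordS d ν z y‖ ≤ constQ d ν e * ‖y‖ := by
  refine le_of_sq_le_sq ?_ (mul_nonneg (constQ_nonneg he) (norm_nonneg _))
  rw [mul_pow, mul_pow, Real.sq_sqrt (by positivity), EuclideanSpace.real_norm_sq_eq]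
  refine le_trans (le_of_eq ?_) (sum_sq_dual_le hn hd hz y (-1) (by norm_num) e he)
  congr 1
  refine Finset.sum_congr rfl fun j _ => ?_
  rw [← neg_sq]
  congr 1
  simp only [coordS, omega_apply, Finset.mul_sum, mul_add, neg_neg, ← Finset.sum_add_distrib]
  exact Finset.sum_congr rfl fun k _ => by simp [eigVec]; ring

end spectral

/-! ### Matrices acting on Euclidean space -/

section action
variable {m : Type*} [Fintype m] [DecidableEq m]

theorem norm_toEuclideanLin_le (A : Matrix m m ℝ) (v : EuclideanSpace ℝ m) :
    ‖Matrix.toEuclideanLin A v‖ ≤ ‖A‖ * ‖v‖ :=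
  Matrix.l2_opNorm_mulVec A v

theorem toEuclideanLin_mul (A B : Matrix m m ℝ) (v : EuclideanSpace ℝ m) :
    Matrix.toEuclideanLin (A * B) v = Matrix.toEuclideanLin A (Matrix.toEuclideanLin B v) := by
  have h := map_mul (Matrix.toEuclideanCLM (𝕜 := ℝ) (n := m)) A B
  exact congrArg (fun T : EuclideanSpace ℝ m →L[ℝ] EuclideanSpace ℝ m => T v) h

theorem toEuclideanLin_one (v : EuclideanSpace ℝ m) :
    Matrix.toEuclideanLin (1 : Matrix m m ℝ) v = v := by
  have h := map_one (Matrix.toEuclideanCLM (𝕜 := ℝ) (n := m))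
  exact congrArg (fun T : EuclideanSpace ℝ m →L[ℝ] EuclideanSpace ℝ m => T v) h

/-- The action of matrices on Euclidean space, as a continuous bilinear map. -/
def matrixAction (m : Type*) [Fintype m] [DecidableEq m] :
    Matrix m m ℝ →L[ℝ] EuclideanSpace ℝ m →L[ℝ] EuclideanSpace ℝ m :=
  LinearMap.toContinuousLinearMap
    (Matrix.toEuclideanCLM (𝕜 := ℝ) (n := m)).toAlgEquiv.toLinearMap

end action

/-! ### The asymptotic solutions at `+∞` -/

section
variable {n : ℕ} {d : Fin n → ℝ} {M : ℝ → Matrix (Fin n) (Fin n) ℝ}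
  {Mm Mp : Matrix (Fin n) (Fin n) ℝ} {CM ηM : ℝ} {ν : Fin n → ℝ} {z : Fin n → Vec n}
  {K L : ℝ} {W : Fin n ⊕ Fin n → ℝ → Phase n}

/-- Only the lower left block differs, and it sees only the first component of a vector. -/
theorem norm_sysMatrix_sub_le (N N' : Matrix (Fin n) (Fin n) ℝ) :
    ‖sysMatrix d N - sysMatrix d N'‖ ≤ ‖N - N'‖ := by
  rw [Matrix.l2_opNorm_def (sysMatrix d N - sysMatrix d N')]
  refine ContinuousLinearMap.opNorm_le_bound _ (norm_nonneg _) fun v => ?_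
  have e : Matrix.toEuclideanLin (sysMatrix d N - sysMatrix d N') v
      = WithLp.toLp 2 (Sum.elim (fun _ => (0 : ℝ)) fun i =>
        -Matrix.toEuclideanLin (N - N') (WithLp.toLp 2 fun i => v (Sum.inl i)) i) := by
    ext r
    rw [map_sub, LinearMap.sub_apply, PiLp.sub_apply]
    rcases r with i | i
    · rw [sysMatrix_apply_inl, sysMatrix_apply_inl]; simp
    · rw [sysMatrix_apply_inr, sysMatrix_apply_inr]
      simp [Matrix.toEuclideanLin, Matrix.mulVec, dotProduct]
      ring
  change ‖Matrix.toEuclideanLin (sysMatrix d N - sysMatrix d N') v‖ ≤ _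
  set p : Vec n := WithLp.toLp 2 fun i => v (Sum.inl i) with hp
  have e1 : ‖Matrix.toEuclideanLin (sysMatrix d N - sysMatrix d N') v‖ ^ 2
      = ‖Matrix.toEuclideanLin (N - N') p‖ ^ 2 := by
    rw [e, norm_sq_phase, EuclideanSpace.real_norm_sq_eq]
    simp only [Sum.elim_inl, Sum.elim_inr, neg_sq]
    simp
  have e2 : ‖p‖ ^ 2 ≤ ‖v‖ ^ 2 := by
    rw [norm_sq_phase, EuclideanSpace.real_norm_sq_eq]
    have : 0 ≤ ∑ i, v (Sum.inr i) ^ 2 := Finset.sum_nonneg fun _ _ => sq_nonneg _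
    simpa [hp] using this
  have e3 : ‖p‖ ≤ ‖v‖ := le_of_sq_le_sq e2 (norm_nonneg _)
  rw [(sq_eq_sq₀ (norm_nonneg _) (norm_nonneg _)).1 e1]
  exact (norm_toEuclideanLin_le _ _).trans (by gcongr)

theorem continuous_sysMatrix (hM : Continuous M) : Continuous fun x => sysMatrix d (M x) :=
  Continuous.matrix_fromBlocks continuous_const continuous_const hM.neg continuous_const

theorem Hyp.CM_nonneg (hH : Hyp d M Mm Mp CM ηM) : 0 ≤ CM := by
  have := (norm_nonneg _).trans (hH.bound_plus 0 le_rfl)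
  simpa using this

theorem contractionConst_nonneg (hH : Hyp d M Mm Mp CM ηM) (hK : 0 < K) :
    0 ≤ contractionConst K CM ηM L := by
  have := hH.CM_nonneg
  have := hH.ηM_pos
  unfold contractionConst
  positivity

theorem norm_evolution_apply_le (hH : Hyp d M Mm Mp CM ηM) {κ : ℝ} {S : Set ℝ} {t y c : ℝ}
    (hy : 0 ≤ y) (he : ‖evolution d Mp ν z κ S t‖ ≤ K) {w : Phase n} (hw : ‖w‖ ≤ c) :
    ‖Matrix.toEuclideanLin (evolution d Mp ν z κ S t * (sysMatrix d (M y) - sysMatrix d Mp)) w‖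
      ≤ K * CM * c * Real.exp (-ηM * y) := by
  have h1 : ‖sysMatrix d (M y) - sysMatrix d Mp‖ ≤ CM * Real.exp (-ηM * y) := by
    have := (norm_sysMatrix_sub_le (d := d) (M y) Mp).trans (hH.bound_plus y hy)
    rwa [abs_of_nonneg hy] at this
  have hK0 : 0 ≤ K := (norm_nonneg _).trans he
  have hc : 0 ≤ c := (norm_nonneg _).trans hw
  refine (norm_toEuclideanLin_le _ _).trans ?_
  calc _ ≤ (K * (CM * Real.exp (-ηM * y))) * c := by
        gcongr
        · exact mul_nonneg hK0 ((norm_nonneg _).trans h1)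
        · exact (norm_mul_le _ _).trans (mul_le_mul he h1 (norm_nonneg _) hK0)
    _ = _ := by ring

theorem norm_evolution_le (hK : IsDichotomyConst d Mp ν z K) (i : Fin n ⊕ Fin n) {t : ℝ}
    (ht : t ≤ 0) : ‖evolution d Mp ν z (rate ν i) (Ici (rate ν i)) t‖ ≤ K := by
  obtain ⟨-, η, -, h⟩ := hK
  exact (h i).1 t ht

theorem norm_evolution_le' (hK : IsDichotomyConst d Mp ν z K) (i : Fin n ⊕ Fin n) {t : ℝ}
    (ht : 0 ≤ t) : ‖evolution d Mp ν z (rate ν i) (Iio (rate ν i)) t‖ ≤ K := by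
  obtain ⟨hK0, η, hη, h⟩ := hK
  refine ((h i).2 t ht).trans ?_
  have : Real.exp (-η * t) ≤ 1 := Real.exp_le_one_iff.2 (by nlinarith)
  nlinarith

/-- Both kernels are bounded by `K`, so the integrals over `[L, x]` and `(x, ∞)` together cost at
most `K C_M c ∫_L^∞ e^{-η_M y} dy`. -/
theorem norm_plusMap_sub_le (hH : Hyp d M Mm Mp CM ηM) (hK : IsDichotomyConst d Mp ν z K)
    (hL : 0 ≤ L) (i : Fin n ⊕ Fin n) {w : ℝ → Phase n} {c : ℝ} (hw : ∀ x ≥ L, ‖w x‖ ≤ c)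
    {x : ℝ} (hx : L ≤ x) :
    ‖plusMap d M Mp ν z L i w x - eigVec d ν z i‖ ≤ contractionConst K CM ηM L * c := by
  have hη := hH.ηM_pos
  have hη' : -ηM < 0 := by linarith
  have h1 := norm_integral_le_of_norm_le (μ := volume.restrict (Ioi x))
    (f := fun y => Matrix.toEuclideanLin
        (evolution d Mp ν z (rate ν i) (Ici (rate ν i)) (x - y)
          * (sysMatrix d (M y) - sysMatrix d Mp)) (w y))
    ((integrableOn_exp_mul_Ioi hη' x).const_mul (K * CM * c))
    ((ae_restrict_iff' measurableSet_Ioi).2 (Eventually.of_forall fun y hy =>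
      norm_evolution_apply_le hH (hL.trans (hx.trans (le_of_lt hy)))
        (norm_evolution_le hK i (by linarith [mem_Ioi.1 hy]))
        (hw y (hx.trans (le_of_lt hy)))))
  have h2 := intervalIntegral.norm_integral_le_of_norm_le (μ := volume) hx
    (f := fun y => Matrix.toEuclideanLin
        (evolution d Mp ν z (rate ν i) (Iio (rate ν i)) (x - y)
          * (sysMatrix d (M y) - sysMatrix d Mp)) (w y))
    (g := fun y => K * CM * c * Real.exp (-ηM * y))
    (Eventually.of_forall fun y hy =>
      norm_evolution_apply_le hH (hL.trans hy.1.le)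
        (norm_evolution_le' hK i (by linarith [hy.2])) (hw y hy.1.le))
    (Continuous.intervalIntegrable (by fun_prop) _ _)
  rw [integral_const_mul, integral_exp_mul_Ioi hη'] at h1
  have h3 : ∫ y in L..x, K * CM * c * Real.exp (-ηM * y)
      = K * CM * c * ((Real.exp (-ηM * x) - Real.exp (-ηM * L)) / (-ηM)) := by
    rw [intervalIntegral.integral_const_mul]
    congr 1
    rw [intervalIntegral.integral_comp_mul_left (fun y => Real.exp y) hη'.ne, integral_exp,
      smul_eq_mul, inv_mul_eq_div]
  rw [h3] at h2
  have e : plusMap d M Mp ν z L i w x - eigVec d ν z i = -(∫ y in Ioi x, Matrix.toEuclideanLin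
        (evolution d Mp ν z (rate ν i) (Ici (rate ν i)) (x - y)
          * (sysMatrix d (M y) - sysMatrix d Mp)) (w y))
    + ∫ y in L..x, Matrix.toEuclideanLin
        (evolution d Mp ν z (rate ν i) (Iio (rate ν i)) (x - y)
          * (sysMatrix d (M y) - sysMatrix d Mp)) (w y) := by
    rw [plusMap]; abel
  rw [e]
  refine (norm_add_le _ _).trans ?_
  rw [norm_neg]
  refine (add_le_add h1 h2).trans (le_of_eq ?_)
  rw [contractionConst]
  field_simp
  ring

theorem eps0_nonneg {lam : ℝ} (h0 : 0 ≤ lam) (h1 : lam < 1) : 0 ≤ eps0 d ν z lam := by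
  have : 0 < 1 - lam := by linarith
  have : 0 ≤ ⨆ i, ‖eigVec d ν z i‖ := Real.iSup_nonneg fun _ => norm_nonneg _
  unfold eps0
  positivity

/-- The fixed points stay within `ε₀` of the eigenvectors. -/
theorem norm_sub_eigVec_le (hH : Hyp d M Mm Mp CM ηM) (hK : IsDichotomyConst d Mp ν z K)
    (hL : 0 ≤ L) (hW : IsAsymptoticFamily d M Mp ν z L W)
    (hlam : contractionConst K CM ηM L < 1) (i : Fin n ⊕ Fin n) {x : ℝ} (hx : L ≤ x) :
    ‖W i x - eigVec d ν z i‖ ≤ eps0 d ν z (contractionConst K CM ηM L) := by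
  obtain ⟨-, ⟨C, hC⟩, hfix⟩ := hW i
  set lam := contractionConst K CM ηM L
  have hlam0 : 0 ≤ lam := contractionConst_nonneg hH hK.1
  have hpos : 0 < 1 - lam := by linarith
  -- The supremum is finite because `W i` is bounded, so `S ≤ ‖V‖ + lam * S` can be solved for `S`.
  set S := sSup ((fun x => ‖W i x‖) '' Ici L)
  have hbdd : BddAbove ((fun x => ‖W i x‖) '' Ici L) := ⟨C, by rintro _ ⟨y, hy, rfl⟩; exact hC y hy⟩
  have hS : ∀ y ≥ L, ‖W i y‖ ≤ S := fun y hy => le_csSup hbdd ⟨y, hy, rfl⟩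
  have hd : ∀ y ≥ L, ‖W i y - eigVec d ν z i‖ ≤ lam * S := fun y hy => by
    rw [hfix y hy]
    exact norm_plusMap_sub_le hH hK hL i hS hy
  have hS' : S ≤ ‖eigVec d ν z i‖ + lam * S := by
    refine csSup_le ⟨_, L, self_mem_Ici, rfl⟩ ?_
    rintro _ ⟨y, hy, rfl⟩
    have := norm_add_le (eigVec d ν z i) (W i y - eigVec d ν z i)
    rw [add_sub_cancel] at this
    exact this.trans (by gcongr; exact hd y hy)
  have hS'' : S ≤ ‖eigVec d ν z i‖ / (1 - lam) := by
    rw [le_div_iff₀ hpos]; linarith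
  have hsup : ‖eigVec d ν z i‖ ≤ ⨆ i, ‖eigVec d ν z i‖ :=
    le_ciSup (f := fun i => ‖eigVec d ν z i‖) (Set.finite_range _).bddAbove i
  calc _ ≤ lam * S := hd x hx
    _ ≤ lam * ((⨆ i, ‖eigVec d ν z i‖) / (1 - lam)) := by
        gcongr
        exact hS''.trans (by gcongr)
    _ = _ := by rw [eps0]; ring

theorem exp_sub_smul (B : Matrix (Fin n ⊕ Fin n) (Fin n ⊕ Fin n) ℝ) (x y : ℝ) :
    NormedSpace.exp ((x - y) • B) = NormedSpace.exp (x • B) * NormedSpace.exp ((-y) • B) := by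
  let _ : NormedAlgebra ℚ (Matrix (Fin n ⊕ Fin n) (Fin n ⊕ Fin n) ℝ) :=
    NormedAlgebra.restrictScalars ℚ ℝ _
  rw [sub_eq_add_neg, add_smul]
  exact NormedSpace.exp_add_of_commute ((Commute.refl B).smul_left x |>.smul_right (-y))

/-- Separating `x` from `y` turns each integral into a matrix exponential in `x` times an integral
whose integrand does not depend on `x`. -/
theorem evolution_sub (κ : ℝ) (S : Set ℝ) (x y : ℝ) :
    evolution d Mp ν z κ S (x - y)
      = NormedSpace.exp (x • (sysMatrix d Mp - κ • (1 : Matrix (Fin n ⊕ Fin n) (Fin n ⊕ Fin n) ℝ)))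
        * evolution d Mp ν z κ S (-y) := by
  rw [evolution, evolution, exp_sub_smul, mul_assoc]

theorem continuous_evolution (κ : ℝ) (S : Set ℝ) :
    Continuous fun y => evolution d Mp ν z κ S (-y) := by
  have h : Continuous fun t : ℝ => NormedSpace.exp
      (t • (sysMatrix d Mp - κ • (1 : Matrix (Fin n ⊕ Fin n) (Fin n ⊕ Fin n) ℝ))) :=
    continuous_iff_continuousAt.2 fun t => (hasDerivAt_exp_smul_const _ t).continuousAt
  exact (h.comp continuous_neg).mul continuous_const

/-- The fixed points solve the differential equation conjugated by `e^{κ x}`. -/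
theorem hasDerivAt_asymptotic (hH : Hyp d M Mm Mp CM ηM) (hz : IsSpectralData d Mp ν z)
    (hK : IsDichotomyConst d Mp ν z K) (hL : 0 ≤ L) (hW : IsAsymptoticFamily d M Mp ν z L W)
    (i : Fin n ⊕ Fin n) {x : ℝ} (hx : L < x) :
    HasDerivAt (W i) (Matrix.toEuclideanLin (sysMatrix d (M x)) (W i x) - rate ν i • W i x) x := by
  obtain ⟨hcont, ⟨C, hC⟩, hfix⟩ := hW i
  set κ := rate ν i with hκ
  set B := sysMatrix d Mp - κ • (1 : Matrix (Fin n ⊕ Fin n) (Fin n ⊕ Fin n) ℝ) with hB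
  set G : Set ℝ → ℝ → Phase n := fun S y => Matrix.toEuclideanLin
    (evolution d Mp ν z κ S (-y) * (sysMatrix d (M y) - sysMatrix d Mp)) (W i y) with hG
  set E : ℝ → Phase n →L[ℝ] Phase n := fun x => matrixAction _ (NormedSpace.exp (x • B)) with hE
  have hGc : ∀ S, ContinuousOn (G S) (Ici L) := by
    intro S
    have h1 : Continuous fun y => matrixAction (Fin n ⊕ Fin n)
        (evolution d Mp ν z κ S (-y) * (sysMatrix d (M y) - sysMatrix d Mp)) :=
      (matrixAction _).continuous.comp ((continuous_evolution κ S).mul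
        ((continuous_sysMatrix hH.continuous).sub continuous_const))
    exact h1.continuousOn.clm_apply hcont
  have hsplit : ∀ S x y, Matrix.toEuclideanLin
      (evolution d Mp ν z κ S (x - y) * (sysMatrix d (M y) - sysMatrix d Mp)) (W i y)
      = E x (G S y) := by
    intro S x y
    rw [evolution_sub, mul_assoc, toEuclideanLin_mul]
    rfl
  -- The first dichotomy bound is used at time `-y`, which is nonpositive because `L ≥ 0`.
  have hint : IntegrableOn (G (Ici κ)) (Ioi L) := by
    refine Integrable.mono' ((integrableOn_exp_mul_Ioi (a := -ηM) (by linarith [hH.ηM_pos]) L).const_mul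
      (K * CM * C)) (((hGc _).mono Ioi_subset_Ici_self).aestronglyMeasurable measurableSet_Ioi) ?_
    refine (ae_restrict_iff' measurableSet_Ioi).2 (Eventually.of_forall fun y hy => ?_)
    have hy' : L ≤ y := le_of_lt hy
    exact norm_evolution_apply_le hH (hL.trans hy') (norm_evolution_le hK i (by linarith)) (hC y hy')
  have hint2 : ∀ S, ∀ y ≥ L, IntervalIntegrable (G S) volume L y := fun S y hy =>
    ((hGc S).mono (by rw [uIcc_of_le hy]; exact Icc_subset_Ici_self)).intervalIntegrable
  have hform : ∀ y ≥ L, W i y = eigVec d ν z i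
      - E y ((∫ t in Ioi L, G (Ici κ) t) - ∫ t in L..y, G (Ici κ) t)
      + E y (∫ t in L..y, G (Iio κ) t) := by
    intro y hy
    rw [hfix y hy, plusMap]
    simp only [← hκ, hsplit]
    rw [(E y).integral_comp_comm (hint.mono_set (Ioi_subset_Ioi hy)),
      (E y).intervalIntegral_comp_comm (hint2 _ y hy),
      ← intervalIntegral.integral_Ioi_sub_Ioi hint hy, sub_sub_cancel]
  have hder : ∀ S, HasDerivAt (fun y => ∫ t in L..y, G S t) (G S x) x := fun S =>
    intervalIntegral.integral_hasDerivAt_right (hint2 S x hx.le)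
      (ContinuousOn.stronglyMeasurableAtFilter isOpen_Ioi
        ((hGc S).mono Ioi_subset_Ici_self) x hx)
      ((hGc S).continuousAt (Ici_mem_nhds hx))
  have hEd : HasDerivAt E (matrixAction _ (B * NormedSpace.exp (x • B))) x :=
    (matrixAction (Fin n ⊕ Fin n)).hasFDerivAt.comp_hasDerivAt x (hasDerivAt_exp_smul_const' B x)
  set I₁ := (∫ t in Ioi L, G (Ici κ) t) - ∫ t in L..x, G (Ici κ) t
  set I₂ := ∫ t in L..x, G (Iio κ) t
  have hD := (((hEd.clm_apply ((hder (Ici κ)).const_sub (∫ t in Ioi L, G (Ici κ) t))).const_sub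
    (eigVec d ν z i)).add (hEd.clm_apply (hder (Iio κ))))
  have hD' := hD.congr_of_eventuallyEq (f₁ := W i) (by
    filter_upwards [Ici_mem_nhds hx] with y hy
    exact hform y hy)
  convert! hD' using 1
  have hEB : ∀ v, (matrixAction _ (B * NormedSpace.exp (x • B))) v
      = Matrix.toEuclideanLin B (E x v) := fun v => toEuclideanLin_mul _ _ _
  -- The boundary terms of the two differentiated integrals: at `y = x` the exponentials disappear
  -- and the complementary projections add up to the identity.
  have hsum : E x (G (Ici κ) x) + E x (G (Iio κ) x)
      = Matrix.toEuclideanLin (sysMatrix d (M x) - sysMatrix d Mp) (W i x) := by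
    rw [← hsplit, ← hsplit, sub_self, ← LinearMap.add_apply, ← map_add, ← add_mul]
    simp only [evolution, zero_smul, NormedSpace.exp_zero, one_mul]
    rw [spectralProj_add hH.d_pos hz, one_mul]
  have hBV : Matrix.toEuclideanLin B (eigVec d ν z i) = 0 := by
    rw [hB, map_sub, LinearMap.sub_apply, sysMatrix_eigVec hH.d_pos hz, map_smul,
      LinearMap.smul_apply, toEuclideanLin_one, sub_self]
  have hBW : Matrix.toEuclideanLin B (W i x) = -Matrix.toEuclideanLin B (E x I₁)
      + Matrix.toEuclideanLin B (E x I₂) := by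
    rw [hform x hx.le, map_add, map_sub, hBV]
    abel
  have hBW' : Matrix.toEuclideanLin B (W i x)
      = Matrix.toEuclideanLin (sysMatrix d Mp) (W i x) - κ • W i x := by
    rw [hB, map_sub, LinearMap.sub_apply, map_smul, LinearMap.smul_apply, toEuclideanLin_one]
  rw [map_sub, LinearMap.sub_apply] at hsum
  rw [hEB, hEB, map_neg]
  change _ = -(Matrix.toEuclideanLin B (E x I₁) + -E x (G (Ici κ) x))
    + (Matrix.toEuclideanLin B (E x I₂) + E x (G (Iio κ) x))
  have e1 : -(Matrix.toEuclideanLin B (E x I₁) + -E x (G (Ici κ) x))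
    + (Matrix.toEuclideanLin B (E x I₂) + E x (G (Iio κ) x))
    = (-Matrix.toEuclideanLin B (E x I₁) + Matrix.toEuclideanLin B (E x I₂))
      + (E x (G (Ici κ) x) + E x (G (Iio κ) x)) := by abel
  rw [e1, ← hBW, hsum, hBW']
  abel

/-- The solution `e^{κ x} W(x)`. -/
theorem hasDerivAt_exp_smul_asymptotic (hH : Hyp d M Mm Mp CM ηM) (hz : IsSpectralData d Mp ν z)
    (hK : IsDichotomyConst d Mp ν z K) (hL : 0 ≤ L) (hW : IsAsymptoticFamily d M Mp ν z L W)
    (i : Fin n ⊕ Fin n) {x : ℝ} (hx : L < x) :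
    HasDerivAt (fun x => Real.exp (rate ν i * x) • W i x)
      (Matrix.toEuclideanLin (sysMatrix d (M x)) (Real.exp (rate ν i * x) • W i x)) x := by
  have h1 : HasDerivAt (fun x => Real.exp (rate ν i * x)) (Real.exp (rate ν i * x) * rate ν i) x := by
    simpa using ((hasDerivAt_id x).const_mul (rate ν i)).exp
  convert! h1.smul (hasDerivAt_asymptotic hH hz hK hL hW i hx) using 1
  rw [map_smul, smul_sub, smul_smul]
  abel

end

/-! ### Calculus on half-lines -/

section calculus

/-- Made for symplectic pairings with the asymptotic solutions, which are differentiable only for `x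
> L`; continuity covers the endpoint. -/
theorem eq_zero_of_deriv_eq_zero_of_tendsto {f : ℝ → ℝ} {L : ℝ} (hc : ContinuousOn f (Ici L))
    (hd : ∀ x > L, HasDerivAt f 0 x) (ht : Tendsto f atTop (𝓝 0)) {x : ℝ} (hx : L ≤ x) :
    f x = 0 := by
  have h : ∀ y > x, f y = f x := by
    intro y hy
    obtain ⟨c, -, hslope⟩ := exists_hasDerivAt_eq_slope f (fun _ => 0) hy
      (hc.mono (Icc_subset_Ici_self.trans (Ici_subset_Ici.2 hx)))
      (fun t ht' => hd t (hx.trans_lt ht'.1))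
    have : y - x ≠ 0 := (sub_pos.2 hy).ne'
    rw [eq_comm, div_eq_zero_iff] at hslope
    rcases hslope with h | h
    · linarith
    · exact absurd h this
  refine tendsto_nhds_unique (tendsto_const_nhds.congr' ?_) ht
  filter_upwards [eventually_gt_atTop x] with y hy
  exact (h y hy).symm

/-- A nonnegative continuous function that is dominated near `±∞` by the derivative of a function
with limit zero at `±∞` is integrable. -/
theorem integrable_of_le_deriv {h h' q : ℝ → ℝ} (hq : Continuous q) (hq0 : ∀ x, 0 ≤ q x)
    (hd : ∀ x, HasDerivAt h (h' x) x) (htop : Tendsto h atTop (𝓝 0))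
    (hbot : Tendsto h atBot (𝓝 0)) {c : ℝ} (hc : 0 < c) {R : ℝ}
    (hdom : ∀ x, R ≤ |x| → c * q x ≤ h' x) : Integrable q := by
  set r := max R 0
  have hdom' : ∀ x, r ≤ |x| → 0 ≤ h' x ∧ ‖q x‖ ≤ c⁻¹ * h' x := by
    intro x hx
    have h1 := hdom x ((le_max_left _ _).trans hx)
    refine ⟨(mul_nonneg hc.le (hq0 x)).trans h1, ?_⟩
    rw [Real.norm_of_nonneg (hq0 x), inv_mul_eq_div, le_div_iff₀ hc]
    linarith
  have hr0 : 0 ≤ r := le_max_right _ _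
  have i1 : IntegrableOn h' (Ioi r) := integrableOn_Ioi_deriv_of_nonneg' (fun x _ => hd x)
    (fun x hx => (hdom' x ((le_of_lt hx).trans (le_abs_self x))).1) htop
  -- The left half-line is reflected: `-h (-x)` has derivative `h' (-x)`.
  have i2 : IntegrableOn (fun x => h' (-x)) (Ioi r) := by
    refine integrableOn_Ioi_deriv_of_nonneg' (g := fun x => -h (-x)) (l := 0) (fun x _ => ?_)
      (fun x hx => (hdom' (-x) ?_).1) ?_
    · have h := ((hd (-x)).scomp x (hasDerivAt_neg x)).neg
      rw [neg_one_smul, neg_neg] at h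
      exact h
    · rw [abs_neg]; exact (le_of_lt hx).trans (le_abs_self x)
    · simpa using (hbot.comp tendsto_neg_atTop_atBot).neg
  have i3 : IntegrableOn h' (Iio (-r)) := by simpa using i2.comp_neg
  rw [integrable_iff_integrableAtFilter_atBot_atTop]
  refine ⟨⟨⟨Iio (-r), Iio_mem_atBot _, ?_⟩, ⟨Ioi r, Ioi_mem_atTop _, ?_⟩⟩, hq.locallyIntegrable⟩
  · refine (i3.const_mul c⁻¹).mono' hq.aestronglyMeasurable ?_
    refine (ae_restrict_iff' measurableSet_Iio).2 (Eventually.of_forall fun x hx => ?_)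
    refine (hdom' x ?_).2
    have hx' : x < -r := hx
    rw [abs_of_neg (by linarith)]; linarith
  · refine (i1.const_mul c⁻¹).mono' hq.aestronglyMeasurable ?_
    refine (ae_restrict_iff' measurableSet_Ioi).2 (Eventually.of_forall fun x hx => ?_)
    exact (hdom' x ((le_of_lt hx).trans (le_abs_self x))).2

end calculus

/-! ### Quadratic forms and the least eigenvalue -/

section quadratic
open scoped MatrixOrder

theorem mul_dotProduct_le_of_le_spectrum {m : Type*} [Fintype m] [DecidableEq m]
    {A : Matrix m m ℝ} (hA : A.IsHermitian) {μ : ℝ} (h : ∀ x ∈ spectrum ℝ A, μ ≤ x) (v : m → ℝ) :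
    μ * (v ⬝ᵥ v) ≤ v ⬝ᵥ A.mulVec v := by
  have h1 : (A - algebraMap ℝ _ μ).PosSemidef := by
    rw [← Matrix.le_iff]
    exact (algebraMap_le_iff_le_spectrum (ha := hA)).2 h
  have h2 := h1.dotProduct_mulVec_nonneg v
  rw [Matrix.sub_mulVec, dotProduct_sub, Algebra.algebraMap_eq_smul_one, Matrix.smul_mulVec,
    Matrix.one_mulVec, dotProduct_smul] at h2
  simp only [star_trivial, smul_eq_mul] at h2
  linarith

/-- Nonemptiness of the index type matters: `sInf` of an empty spectrum would be zero. -/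
theorem sInf_spectrum_pos {m : Type*} [Fintype m] [DecidableEq m] [Nonempty m]
    {A : Matrix m m ℝ} (hA : A.PosDef) :
    0 < sInf (spectrum ℝ A) ∧ ∀ x ∈ spectrum ℝ A, sInf (spectrum ℝ A) ≤ x := by
  have hs := hA.isHermitian.spectrum_real_eq_range_eigenvalues
  have hf : (spectrum ℝ A).Finite := by rw [hs]; exact Set.finite_range _
  have hne : (spectrum ℝ A).Nonempty := by rw [hs]; exact Set.range_nonempty _
  refine ⟨?_, fun x hx => csInf_le hf.bddBelow hx⟩
  have := hne.csInf_mem hf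
  rw [hs] at this
  obtain ⟨i, hi⟩ := this
  rw [hs, ← hi]
  exact hA.eigenvalues_pos i

end quadratic

/-! ### Solutions on the line -/

section solutions
variable {n : ℕ} {d : Fin n → ℝ} {M : ℝ → Matrix (Fin n) (Fin n) ℝ}
  {Mm Mp : Matrix (Fin n) (Fin n) ℝ} {CM ηM : ℝ}

theorem hasDerivAt_coord {m : Type*} [Fintype m] {U : ℝ → EuclideanSpace ℝ m}
    {U' : EuclideanSpace ℝ m} {x : ℝ} (h : HasDerivAt U U' x) (r : m) :
    HasDerivAt (fun y => U y r) (U' r) x :=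
  (EuclideanSpace.proj (𝕜 := ℝ) r).hasFDerivAt.comp_hasDerivAt x h

/-- The symplectic form of two solutions is constant. -/
theorem hasDerivAt_omega {N : Matrix (Fin n) (Fin n) ℝ} (hN : N.IsSymm) {U V : ℝ → Phase n} {x : ℝ}
    (hU : HasDerivAt U (Matrix.toEuclideanLin (sysMatrix d N) (U x)) x)
    (hV : HasDerivAt V (Matrix.toEuclideanLin (sysMatrix d N) (V x)) x) :
    HasDerivAt (fun y => omega (U y) (V y)) 0 x := by
  simp only [omega_apply]
  have h := HasDerivAt.fun_sum (u := Finset.univ) fun (i : Fin n) _ =>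
    ((hasDerivAt_coord hU (Sum.inl i)).mul (hasDerivAt_coord hV (Sum.inr i))).sub
      ((hasDerivAt_coord hU (Sum.inr i)).mul (hasDerivAt_coord hV (Sum.inl i)))
  convert! h using 1
  simp only [sysMatrix_apply_inl, sysMatrix_apply_inr]
  -- The `D⁻¹` terms cancel for each `i` separately; the potential terms cancel only after
  -- summation, by symmetry of `N`.
  have e : ∑ i, ∑ j, U x (Sum.inl i) * (N i j * V x (Sum.inl j))
      = ∑ i, ∑ j, N i j * U x (Sum.inl j) * V x (Sum.inl i) := by
    rw [Finset.sum_comm]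
    refine Finset.sum_congr rfl fun i _ => Finset.sum_congr rfl fun j _ => ?_
    rw [hN.apply]
    ring
  have e2 : ∀ i, (d i)⁻¹ * U x (Sum.inr i) * V x (Sum.inr i)
      + U x (Sum.inl i) * -∑ j, N i j * V x (Sum.inl j)
      - ((-∑ j, N i j * U x (Sum.inl j)) * V x (Sum.inl i)
        + U x (Sum.inr i) * ((d i)⁻¹ * V x (Sum.inr i)))
      = ∑ j, N i j * U x (Sum.inl j) * V x (Sum.inl i)
        - ∑ j, U x (Sum.inl i) * (N i j * V x (Sum.inl j)) := by
    intro i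
    rw [← Finset.sum_mul, ← Finset.mul_sum]
    ring
  rw [Finset.sum_congr rfl fun i _ => e2 i, Finset.sum_sub_distrib, e, sub_self]

theorem tendsto_omega {U V : ℝ → Phase n} {l : Filter ℝ} (hU : Tendsto U l (𝓝 0))
    (hV : Tendsto V l (𝓝 0)) : Tendsto (fun x => omega (U x) (V x)) l (𝓝 0) := by
  refine squeeze_zero_norm (fun x => abs_omega_le (U x) (V x)) ?_
  simpa using hU.norm.mul hV.norm

theorem continuousOn_omega {U V : ℝ → Phase n} {s : Set ℝ} (hU : ContinuousOn U s)
    (hV : ContinuousOn V s) : ContinuousOn (fun x => omega (U x) (V x)) s := by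
  simp only [omega_apply]
  fun_prop

theorem IsSolution.continuous {U : ℝ → Phase n} (hU : IsSolution d M U) : Continuous U :=
  continuous_iff_continuousAt.2 fun x => (hU x).continuousAt

/-- A constant that tends to zero at `-∞`: this is isotropy of the unstable subspace. -/
theorem IsSolution.omega_eq_zero (hM : ∀ x, (M x).IsSymm) {U V : ℝ → Phase n}
    (hU : IsSolution d M U) (hV : IsSolution d M V) (tU : Tendsto U atBot (𝓝 0))
    (tV : Tendsto V atBot (𝓝 0)) (x : ℝ) : omega (U x) (V x) = 0 := by
  have hd := fun y => hasDerivAt_omega (hM y) (hU y) (hV y)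
  have hc := is_const_of_deriv_eq_zero (fun y => (hd y).differentiableAt) fun y => (hd y).deriv
  refine tendsto_nhds_unique (tendsto_const_nhds.congr fun y => ?_) (tendsto_omega tU tV)
  exact hc x y

theorem IsSolution.smul {U : ℝ → Phase n} (c : ℝ) (hU : IsSolution d M U) :
    IsSolution d M (fun x => c • U x) := fun x => by
  rw [map_smul]
  exact (hU x).const_smul c

theorem IsSolution.sub {U V : ℝ → Phase n} (hU : IsSolution d M U) (hV : IsSolution d M V) :
    IsSolution d M (fun x => U x - V x) := fun x => by
  rw [map_sub]
  exact (hU x).sub (hV x)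

theorem IsSolution.sum {ι : Type*} [Fintype ι] {U : ι → ℝ → Phase n}
    (hU : ∀ i, IsSolution d M (U i)) : IsSolution d M (fun x => ∑ i, U i x) := fun x => by
  rw [map_sum]
  exact HasDerivAt.fun_sum fun i _ => hU i x

/-- Serves both as the Lipschitz constant for uniqueness and to show that the derivative of a square
integrable solution is square integrable. -/
theorem Hyp.exists_bound (hH : Hyp d M Mm Mp CM ηM) : ∃ C, 0 ≤ C ∧ ∀ x, ‖sysMatrix d (M x)‖ ≤ C := by
  have hCM := hH.CM_nonneg
  have hexp : ∀ x, Real.exp (-ηM * |x|) ≤ 1 := fun x =>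
    Real.exp_le_one_iff.2 (by nlinarith [hH.ηM_pos, abs_nonneg x])
  refine ⟨‖sysMatrix d Mp‖ + ‖sysMatrix d Mm‖ + CM, by positivity, fun x => ?_⟩
  rcases le_total 0 x with hx | hx
  · have h1 := (norm_sysMatrix_sub_le (d := d) (M x) Mp).trans (hH.bound_plus x hx)
    have h2 := norm_add_le (sysMatrix d (M x) - sysMatrix d Mp) (sysMatrix d Mp)
    rw [sub_add_cancel] at h2
    have := norm_nonneg (sysMatrix d Mm)
    nlinarith [hexp x]
  · have h1 := (norm_sysMatrix_sub_le (d := d) (M x) Mm).trans (hH.bound_minus x hx)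
    have h2 := norm_add_le (sysMatrix d (M x) - sysMatrix d Mm) (sysMatrix d Mm)
    rw [sub_add_cancel] at h2
    have := norm_nonneg (sysMatrix d Mp)
    nlinarith [hexp x]

/-- Solutions are determined by their value at one point. -/
theorem IsSolution.eq_of_apply_eq (hH : Hyp d M Mm Mp CM ηM) {U V : ℝ → Phase n}
    (hU : IsSolution d M U) (hV : IsSolution d M V) {x : ℝ} (h : U x = V x) : U = V := by
  obtain ⟨C, hC0, hC⟩ := hH.exists_bound
  refine ODE_solution_unique_univ (v := fun t w => Matrix.toEuclideanLin (sysMatrix d (M t)) w)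
    (s := fun _ => univ) (K := ⟨C, hC0⟩) (fun t => ?_) (fun t => ⟨hU t, mem_univ _⟩)
    (fun t => ⟨hV t, mem_univ _⟩) h
  refine (LipschitzWith.of_dist_le_mul fun p q => ?_).lipschitzOnWith
  rw [dist_eq_norm, dist_eq_norm, ← map_sub]
  exact (norm_toEuclideanLin_le _ _).trans (by gcongr; exact hC t)

theorem exists_coercive {N : Matrix (Fin n) (Fin n) ℝ} (hN : IsNegDefDistinct N) :
    ∃ c > 0, ∀ v : Fin n → ℝ, c * (v ⬝ᵥ v) ≤ -(v ⬝ᵥ N.mulVec v) := by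
  rcases isEmpty_or_nonempty (Fin n) with _ | _
  · exact ⟨1, one_pos, fun v => by simp [dotProduct]⟩
  · obtain ⟨h1, h2⟩ := sInf_spectrum_pos hN.negDef
    refine ⟨_, h1, fun v => ?_⟩
    have := mul_dotProduct_le_of_le_spectrum hN.negDef.isHermitian h2 v
    rwa [Matrix.neg_mulVec, dotProduct_neg] at this

theorem dotProduct_sub_mulVec_le (N N' : Matrix (Fin n) (Fin n) ℝ) (v : Fin n → ℝ) :
    v ⬝ᵥ (N - N').mulVec v ≤ ‖N - N'‖ * (v ⬝ᵥ v) := by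
  set p : Vec n := WithLp.toLp 2 v
  have h1 : v ⬝ᵥ (N - N').mulVec v = inner ℝ p (Matrix.toEuclideanLin (N - N') p) :=
    (Matrix.inner_toEuclideanCLM (N - N') p p).symm
  have h2 : v ⬝ᵥ v = ‖p‖ * ‖p‖ := by
    rw [← pow_two, EuclideanSpace.real_norm_sq_eq, dotProduct]
    exact Finset.sum_congr rfl fun i _ => (pow_two _).symm
  rw [h1, h2]
  refine (real_inner_le_norm _ _).trans ?_
  have := norm_toEuclideanLin_le (N - N') p
  nlinarith [norm_nonneg p]

/-- Far out, `M x` is so close to a negative definite limit that at most half of the coercivity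
constant is lost. -/
theorem Hyp.exists_coercive (hH : Hyp d M Mm Mp CM ηM) :
    ∃ c > 0, ∃ R, ∀ x, R ≤ |x| → ∀ v : Fin n → ℝ, c * (v ⬝ᵥ v) ≤ -(v ⬝ᵥ (M x).mulVec v) := by
  obtain ⟨c₁, h₁, k₁⟩ := ConjPt.exists_coercive hH.plus
  obtain ⟨c₂, h₂, k₂⟩ := ConjPt.exists_coercive hH.minus
  obtain ⟨R₁, hR₁⟩ := eventually_atTop.1 (hH.tendsto_plus.eventually
    (Metric.ball_mem_nhds Mp (half_pos h₁)))
  obtain ⟨R₂, hR₂⟩ := eventually_atBot.1 (hH.tendsto_minus.eventually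
    (Metric.ball_mem_nhds Mm (half_pos h₂)))
  have aux : ∀ (N N' : Matrix (Fin n) (Fin n) ℝ) (c : ℝ), dist N N' < c / 2 →
      (∀ v : Fin n → ℝ, c * (v ⬝ᵥ v) ≤ -(v ⬝ᵥ N'.mulVec v)) →
      ∀ v : Fin n → ℝ, c / 2 * (v ⬝ᵥ v) ≤ -(v ⬝ᵥ N.mulVec v) := by
    intro N N' c h k v
    have h3 := dotProduct_sub_mulVec_le N N' v
    rw [dist_eq_norm] at h
    have h0 : 0 ≤ v ⬝ᵥ v := Finset.sum_nonneg fun i _ => mul_self_nonneg _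
    have h4 := k v
    rw [Matrix.sub_mulVec, dotProduct_sub] at h3
    nlinarith
  refine ⟨min (c₁ / 2) (c₂ / 2), by positivity, max R₁ (-R₂), fun x hx v => ?_⟩
  have h0 : 0 ≤ v ⬝ᵥ v := Finset.sum_nonneg fun i _ => mul_self_nonneg _
  rcases le_total 0 x with h | h
  · rw [abs_of_nonneg h] at hx
    have := aux _ _ _ (hR₁ x ((le_max_left _ _).trans hx)) k₁ v
    exact le_trans (by gcongr; exact min_le_left _ _) this
  · rw [abs_of_nonpos h] at hx
    have := aux _ _ _ (hR₂ x (by linarith [(le_max_right R₁ (-R₂)).trans hx])) k₂ v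
    exact le_trans (by gcongr; exact min_le_right _ _) this

/-- Solutions that decay at both ends are square integrable. -/
theorem IsSolution.memLp (hH : Hyp d M Mm Mp CM ηM) {U : ℝ → Phase n} (hU : IsSolution d M U)
    (ht : Tendsto U atTop (𝓝 0)) (hb : Tendsto U atBot (𝓝 0)) : MemLp U 2 := by
  have hc := hU.continuous
  rw [memLp_two_iff_integrable_sq_norm hc.aestronglyMeasurable]
  obtain ⟨c, hc0, R, hR⟩ := hH.exists_coercive
  obtain ⟨δ, hδ0, hδ⟩ : ∃ δ > 0, ∀ i, δ ≤ (d i)⁻¹ := by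
    rcases isEmpty_or_nonempty (Fin n) with _ | _
    · exact ⟨1, one_pos, fun i => isEmptyElim i⟩
    · obtain ⟨j, hj⟩ := Finite.exists_min fun i => (d i)⁻¹
      exact ⟨_, inv_pos.2 (hH.d_pos j), hj⟩
  -- The pairing `⟪u, w⟫` has derivative `⟪D⁻¹ w, w⟫ - ⟪u, M u⟫`, which dominates a multiple of `‖U‖
  -- ^ 2` near both ends. Mere convergence to zero therefore gives square integrability without a
  -- decay rate.
  have hder : ∀ x, HasDerivAt (fun y => ∑ i, U y (Sum.inl i) * U y (Sum.inr i))
      (∑ i, (d i)⁻¹ * U x (Sum.inr i) ^ 2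
        - (fun i => U x (Sum.inl i)) ⬝ᵥ (M x).mulVec fun i => U x (Sum.inl i)) x := by
    intro x
    have h := HasDerivAt.fun_sum (u := Finset.univ) fun (i : Fin n) _ =>
      (hasDerivAt_coord (hU x) (Sum.inl i)).mul (hasDerivAt_coord (hU x) (Sum.inr i))
    convert! h using 1
    rw [dotProduct, ← Finset.sum_sub_distrib]
    refine Finset.sum_congr rfl fun i _ => ?_
    rw [sysMatrix_apply_inl, sysMatrix_apply_inr, Matrix.mulVec, dotProduct]
    ring
  have hlim : ∀ l : Filter ℝ, Tendsto U l (𝓝 0) →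
      Tendsto (fun y => ∑ i, U y (Sum.inl i) * U y (Sum.inr i)) l (𝓝 0) := by
    intro l hl
    have h1 : Continuous fun p : Phase n => ∑ i, p (Sum.inl i) * p (Sum.inr i) := by fun_prop
    simpa [Function.comp_def] using (h1.tendsto 0).comp hl
  refine integrable_of_le_deriv (by fun_prop) (fun x => by positivity) hder (hlim _ ht) (hlim _ hb)
    (lt_min hc0 hδ0) (R := R) fun x hx => ?_
  have h1 := hR x hx fun i => U x (Sum.inl i)
  rw [norm_sq_phase, mul_add]
  have h2 : min c δ * ∑ i, U x (Sum.inl i) ^ 2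
      ≤ c * ((fun i => U x (Sum.inl i)) ⬝ᵥ fun i => U x (Sum.inl i)) := by
    simp only [dotProduct, ← pow_two]
    gcongr
    exact min_le_left _ _
  have h3 : min c δ * ∑ i, U x (Sum.inr i) ^ 2 ≤ ∑ i, (d i)⁻¹ * U x (Sum.inr i) ^ 2 := by
    rw [Finset.mul_sum]
    gcongr with i
    exact (min_le_right _ _).trans (hδ i)
  linarith

end solutions

/-! ### Decaying solutions and the kernel of the operator -/

theorem isWeakDeriv_toLp {n : ℕ} {F G : ℝ → Vec n} (hFG : ∀ x, HasDerivAt F (G x) x)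
    (hG : Continuous G) (mF : MemLp F 2) (mG : MemLp G 2) :
    IsWeakDeriv ⇑(mF.toLp F) ⇑(mG.toLp G) := by
  intro φ hφ hs
  have hF : Continuous F := continuous_iff_continuousAt.2 fun x => (hFG x).continuousAt
  have hd : Continuous (deriv φ) := hφ.continuous_deriv (by simp)
  have e₁ : ∫ x, deriv φ x • (mF.toLp F) x = ∫ x, deriv φ x • F x := by
    refine integral_congr_ae ?_
    filter_upwards [mF.coeFn_toLp] with x hx
    rw [hx]
  have e₂ : ∫ x, φ x • (mG.toLp G) x = ∫ x, φ x • G x := by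
    refine integral_congr_ae ?_
    filter_upwards [mG.coeFn_toLp] with x hx
    rw [hx]
  rw [e₁, e₂]
  have h := integral_bilinear_hasDerivAt_right_eq_neg_left_of_integrable
    (L := ContinuousLinearMap.lsmul ℝ ℝ (E := Vec n)) (u := φ) (u' := deriv φ) (v := F) (v' := G)
    (fun x _ => (hφ.differentiable (by simp) x).hasDerivAt) (fun x _ => hFG x)
    ((hφ.continuous.smul hG).integrable_of_hasCompactSupport hs.smul_right)
    ((hd.smul hF).integrable_of_hasCompactSupport hs.deriv.smul_right)
    ((hφ.continuous.smul hF).integrable_of_hasCompactSupport hs.smul_right)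
  simp only [ContinuousLinearMap.lsmul_apply] at h
  rw [h, neg_neg]

/-- The first component of a phase vector. -/
def fstL (n : ℕ) : Phase n →L[ℝ] Vec n :=
  LinearMap.toContinuousLinearMap
    { toFun := fun p => WithLp.toLp 2 fun i => p (Sum.inl i)
      map_add' := fun p q => by ext i; simp
      map_smul' := fun c p => by ext i; simp }

/-- The second component of a phase vector. -/
def sndL (n : ℕ) : Phase n →L[ℝ] Vec n :=
  LinearMap.toContinuousLinearMap
    { toFun := fun p => WithLp.toLp 2 fun i => p (Sum.inr i)
      map_add' := fun p q => by ext i; simp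
      map_smul' := fun c p => by ext i; simp }

theorem fstL_apply {n : ℕ} (p : Phase n) (i : Fin n) : fstL n p i = p (Sum.inl i) := rfl

section
variable {n : ℕ} {d : Fin n → ℝ} {M : ℝ → Matrix (Fin n) (Fin n) ℝ}
  {Mm Mp : Matrix (Fin n) (Fin n) ℝ} {CM ηM : ℝ}

theorem toEuclideanLin_diagonal_apply (a : Fin n → ℝ) (v : Vec n) (i : Fin n) :
    Matrix.toEuclideanLin (Matrix.diagonal a) v i = a i * v i := by
  simp [Matrix.toEuclideanLin, Matrix.mulVec_diagonal]

/-- The first component of a solution that decays at both ends lies in `ker L`. -/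
theorem IsSolution.toLp_mem_kerPow (hH : Hyp d M Mm Mp CM ηM) {U : ℝ → Phase n}
    (hU : IsSolution d M U) (mU : MemLp U 2 volume) :
    ((fstL n).comp_memLp' mU).toLp (fstL n ∘ U) ∈ kerPow d M 1 := by
  set U' : ℝ → Phase n := fun x => Matrix.toEuclideanLin (sysMatrix d (M x)) (U x) with hU'
  have cU' : Continuous U' :=
    ((matrixAction (Fin n ⊕ Fin n)).continuous.comp
      (continuous_sysMatrix (d := d) hH.continuous)).clm_apply hU.continuous
  obtain ⟨C, hC0, hC⟩ := hH.exists_bound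
  have mU' : MemLp U' 2 := mU.of_le_mul (c := C) cU'.aestronglyMeasurable
    (Eventually.of_forall fun x => (norm_toEuclideanLin_le _ _).trans (by gcongr; exact hC x))
  -- The map `(u, w) ↦ D⁻¹ w`: applied to `U` it gives `u'`, applied to `U'` it gives `u''`.
  set T : Phase n →L[ℝ] Vec n :=
    (matrixAction (Fin n) (Matrix.diagonal fun i => (d i)⁻¹)).comp (sndL n)
  have hT : ∀ x, fstL n (U' x) = T (U x) := by
    intro x
    ext i
    rw [fstL_apply, hU', sysMatrix_apply_inl]
    exact (toEuclideanLin_diagonal_apply (fun i => (d i)⁻¹) (sndL n (U x)) i).symm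
  have mf := (fstL n).comp_memLp' mU
  have mv := T.comp_memLp' mU
  have mw := T.comp_memLp' mU'
  refine Submodule.mem_map.2 ⟨(mf.toLp _, 0), ⟨⟨mv.toLp _, mw.toLp _, ?_, ?_, ?_⟩, ?_⟩, rfl⟩
  · refine isWeakDeriv_toLp (fun x => ?_) (T.continuous.comp hU.continuous) mf mv
    have := (fstL n).hasFDerivAt.comp_hasDerivAt x (hU x)
    change HasDerivAt _ (T (U x)) x
    rw [← hT]
    exact this
  · refine isWeakDeriv_toLp (fun x => ?_) (T.continuous.comp cU') mv mw
    exact T.hasFDerivAt.comp_hasDerivAt x (hU x)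
  · filter_upwards [mf.coeFn_toLp, mw.coeFn_toLp, Lp.coeFn_zero (Vec n) 2 (volume : Measure ℝ)]
      with x h1 h2 h3
    rw [h1, h2, h3]
    ext i
    have h4 : T (U' x) i = (d i)⁻¹ * U' x (Sum.inr i) := toEuclideanLin_diagonal_apply _ _ _
    have h5 := (hH.d_pos i).ne'
    rw [PiLp.add_apply, toEuclideanLin_diagonal_apply, Function.comp_apply, Function.comp_apply, h4,
      hU', sysMatrix_apply_inr, mul_inv_cancel_left₀ h5]
    simp [Matrix.toEuclideanLin, Matrix.mulVec, dotProduct, fstL_apply]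
  · exact (kerPow d M 0).zero_mem

/-- A solution whose first component vanishes is zero. -/
theorem IsSolution.eq_zero_of_fst (hd : ∀ i, 0 < d i) {U : ℝ → Phase n} (hU : IsSolution d M U)
    (h : ∀ x, fstL n (U x) = 0) (x : ℝ) : U x = 0 := by
  have h0 : ∀ y i, U y (Sum.inl i) = 0 := fun y i => by
    rw [← fstL_apply, h y]; rfl
  ext r
  rcases r with i | i
  · exact h0 x i
  · have h1 := hasDerivAt_coord (hU x) (Sum.inl i)
    rw [funext fun y => h0 y i, sysMatrix_apply_inl] at h1
    have h2 := h1.unique (hasDerivAt_const x (0 : ℝ))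
    simpa [(hd i).ne'] using h2

/-- By simplicity of the eigenvalue zero, solutions that decay at both ends are proportional. -/
theorem IsSolution.exists_smul_eq (hH : Hyp d M Mm Mp CM ηM) {U V : ℝ → Phase n}
    (hU : IsSolution d M U) (hV : IsSolution d M V)
    (tU : Tendsto U atTop (𝓝 0)) (bU : Tendsto U atBot (𝓝 0))
    (tV : Tendsto V atTop (𝓝 0)) (bV : Tendsto V atBot (𝓝 0)) (h0 : ∃ x, U x ≠ 0) :
    ∃ c : ℝ, ∀ x, V x = c • U x := by
  have mU := hU.memLp hH tU bU
  have mV := hV.memLp hH tV bV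
  set u : kerPow d M 1 := ⟨_, hU.toLp_mem_kerPow hH mU⟩
  set v : kerPow d M 1 := ⟨_, hV.toLp_mem_kerPow hH mV⟩
  have eU := ((fstL n).comp_memLp' mU).coeFn_toLp
  have eV := ((fstL n).comp_memLp' mV).coeFn_toLp
  have cU := (fstL n).continuous.comp hU.continuous
  have cV := (fstL n).continuous.comp hV.continuous
  have hu : u ≠ 0 := by
    intro hu
    obtain ⟨x, hx⟩ := h0
    have h1 : ((fstL n).comp_memLp' mU).toLp (fstL n ∘ U) = 0 := congrArg Subtype.val hu
    rw [h1] at eU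
    have h2 : (fstL n ∘ U) =ᵐ[volume] fun _ => 0 :=
      eU.symm.trans (Lp.coeFn_zero (Vec n) 2 (volume : Measure ℝ))
    -- Continuous functions that agree almost everywhere agree everywhere.
    have h3 := (cU.ae_eq_iff_eq volume continuous_const).1 h2
    exact hx (hU.eq_zero_of_fst hH.d_pos (congrFun h3) x)
  obtain ⟨c, hc⟩ := (finrank_eq_one_iff_of_nonzero' u hu).1 hH.simple.1 v
  refine ⟨c, fun x => ?_⟩
  have h1 : c • ((fstL n).comp_memLp' mU).toLp (fstL n ∘ U)
      = ((fstL n).comp_memLp' mV).toLp (fstL n ∘ V) := congrArg Subtype.val hc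
  have h2 : (fstL n ∘ V) =ᵐ[volume] fun x => c • (fstL n ∘ U) x := by
    have h3 := Lp.coeFn_smul c (((fstL n).comp_memLp' mU).toLp (fstL n ∘ U))
    rw [h1] at h3
    filter_upwards [eU, eV, h3] with x k1 k2 k3
    rw [← k2, k3, Pi.smul_apply, k1]
  have h3 := (cV.ae_eq_iff_eq volume (cU.const_smul c)).1 h2
  -- Membership in the kernel controls only first components; the second one is recovered from `w =
  -- D u'`.
  refine sub_eq_zero.1 ((hV.sub (hU.smul c)).eq_zero_of_fst hH.d_pos (fun y => ?_) x)
  rw [map_sub, map_smul]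
  exact sub_eq_zero.2 (congrFun h3 y)

variable {Uφ : ℝ → Phase n} {U : Fin (n - 1) → ℝ → Phase n}

/-- Solutions with values in `E₋ᵘ` decay at `-∞`. -/
theorem IsSolution.tendsto_atBot (hH : Hyp d M Mm Mp CM ηM) {V : ℝ → Phase n}
    (hV : IsSolution d M V) (h : V 0 ∈ unstableSubspace d M 0) : Tendsto V atBot (𝓝 0) := by
  obtain ⟨V', hV', tV', e⟩ := h
  rwa [← hV'.eq_of_apply_eq hH hV e]

theorem IsFrame.tendsto_atBot_φ (hH : Hyp d M Mm Mp CM ηM) (hU : IsFrame d M Uφ U) :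
    Tendsto Uφ atBot (𝓝 0) :=
  hU.sol_φ.tendsto_atBot hH (by
    rw [← hU.span]; exact Submodule.subset_span ⟨none, rfl⟩)

theorem IsFrame.tendsto_atBot (hH : Hyp d M Mm Mp CM ηM) (hU : IsFrame d M Uφ U)
    (k : Fin (n - 1)) : Tendsto (U k) atBot (𝓝 0) :=
  (hU.sol k).tendsto_atBot hH (by
    rw [← hU.span]; exact Submodule.subset_span ⟨some k, rfl⟩)

theorem IsFrame.exists_coeff (hU : IsFrame d M Uφ U) {x : ℝ} {v : Phase n}
    (hv : v ∈ unstableSubspace d M x) :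
    ∃ (t : ℝ) (c : Fin (n - 1) → ℝ), v = t • Uφ x + ∑ k, c k • U k x := by
  rw [← hU.span] at hv
  obtain ⟨c, rfl⟩ := (Submodule.mem_span_range_iff_exists_fun ℝ).1 hv
  exact ⟨c none, fun k => c (some k), by rw [Fintype.sum_option]; rfl⟩

/-- No nontrivial combination of the `Uₖ` decays at `+∞`. -/
theorem IsFrame.eq_zero_of_tendsto (hH : Hyp d M Mm Mp CM ηM) (hU : IsFrame d M Uφ U)
    (c : Fin (n - 1) → ℝ) (h : Tendsto (fun x => ∑ k, c k • U k x) atTop (𝓝 0)) : c = 0 := by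
  have hs : IsSolution d M fun x => ∑ k, c k • U k x := IsSolution.sum fun k => (hU.sol k).smul (c k)
  have hb : Tendsto (fun x => ∑ k, c k • U k x) atBot (𝓝 0) := by
    have := tendsto_finsetSum Finset.univ fun k _ => (hU.tendsto_atBot hH k).const_smul (c k)
    simpa using this
  -- The combination decays at both ends, so it is a multiple of `Uφ`, and independence of the frame
  -- applies.
  obtain ⟨a, ha⟩ := hU.sol_φ.exists_smul_eq hH hs hU.decay_φ (hU.tendsto_atBot_φ hH) h hb
    ⟨0, (hU.linearIndependent 0).ne_zero none⟩
  have h1 := Fintype.linearIndependent_iff.1 (hU.linearIndependent 0)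
    (fun o => o.elim (-a) c) (by
      rw [Fintype.sum_option]
      simpa using neg_add_eq_zero.2 (ha 0).symm)
  exact funext fun k => h1 (some k)

end

/-! ### Linear algebra at a fixed point -/

section pointwise
variable {n : ℕ} {d : Fin n → ℝ} {Mp : Matrix (Fin n) (Fin n) ℝ} {ν : Fin n → ℝ} {z : Fin n → Vec n}
  {e : ℝ}

theorem coordU_add (p q : Phase n) :
    coordU d ν z (p + q) = coordU d ν z p + coordU d ν z q := by
  ext j; simp [coordU]

theorem coordS_add (p q : Phase n) :
    coordS d ν z (p + q) = coordS d ν z p + coordS d ν z q := by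
  ext j; simp [coordS]; ring

theorem norm_sum_smul_le {w : Fin n → Phase n} (hw : ∀ j, ‖w j‖ ≤ e) (g : Vec n) :
    ‖∑ j, g j • w j‖ ≤ e * (√n * ‖g‖) := by
  rcases isEmpty_or_nonempty (Fin n) with _ | ⟨⟨i⟩⟩
  · simp [Subsingleton.elim g 0]
  have he : 0 ≤ e := (norm_nonneg _).trans (hw i)
  have h1 : ∑ j, |g j| ≤ √n * ‖g‖ := by
    refine le_of_sq_le_sq ?_ (by positivity)
    rw [mul_pow, Real.sq_sqrt (by positivity), EuclideanSpace.real_norm_sq_eq]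
    have := sq_sum_le_card_mul_sum_sq (s := Finset.univ) (f := fun j => |g j|)
    simpa using this
  calc _ ≤ ∑ j, |g j| * e := norm_sum_le_of_le _ fun j _ => by
        rw [norm_smul, Real.norm_eq_abs]
        gcongr
        exact hw j
    _ = e * ∑ j, |g j| := by rw [← Finset.sum_mul, mul_comm]
    _ ≤ _ := by gcongr

/-- The `√n` from the triangle inequality cancels the one in `norm_coordU_le`, so moving each basis
vector by `e` changes coordinates by the relative amount `e * constQ d ν e`. -/
theorem norm_coordU_sum_le (hn : 1 ≤ n) (hd : ∀ i, 0 < d i) (hz : IsSpectralData d Mp ν z)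
    (he : 0 ≤ e) {w : Fin n → Phase n} (hw : ∀ j, ‖w j‖ ≤ e) (g : Vec n) :
    ‖coordU d ν z (∑ j, g j • w j)‖ ≤ e * constQ d ν e * ‖g‖ := by
  have h1 := norm_coordU_le hn hd hz he (∑ j, g j • w j)
  have h2 := norm_sum_smul_le hw g
  have hq := constQ_nonneg (d := d) (ν := ν) he
  have hn' : 0 < √(n : ℝ) := Real.sqrt_pos.2 (by exact_mod_cast hn)
  refine le_of_mul_le_mul_left (h1.trans ?_) hn'
  calc _ ≤ constQ d ν e * (e * (√n * ‖g‖)) := by gcongr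
    _ = _ := by ring

theorem norm_coordS_sum_le (hn : 1 ≤ n) (hd : ∀ i, 0 < d i) (hz : IsSpectralData d Mp ν z)
    (he : 0 ≤ e) {w : Fin n → Phase n} (hw : ∀ j, ‖w j‖ ≤ e) (g : Vec n) :
    ‖coordS d ν z (∑ j, g j • w j)‖ ≤ e * constQ d ν e * ‖g‖ := by
  have h1 := norm_coordS_le hn hd hz he (∑ j, g j • w j)
  have h2 := norm_sum_smul_le hw g
  have hq := constQ_nonneg (d := d) (ν := ν) he
  have hn' : 0 < √(n : ℝ) := Real.sqrt_pos.2 (by exact_mod_cast hn)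
  refine le_of_mul_le_mul_left (h1.trans ?_) hn'
  calc _ ≤ constQ d ν e * (e * (√n * ‖g‖)) := by gcongr
    _ = _ := by ring

theorem coordU_sum_inl (hd : ∀ i, 0 < d i) (hz : IsSpectralData d Mp ν z) (g : Vec n) :
    coordU d ν z (∑ j, g j • eigVec d ν z (Sum.inl j)) = g := by
  ext j; simp [coordU, omega_inr_inl hd hz]

theorem coordU_sum_inr (hd : ∀ i, 0 < d i) (hz : IsSpectralData d Mp ν z) (g : Vec n) :
    coordU d ν z (∑ j, g j • eigVec d ν z (Sum.inr j)) = 0 := by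
  ext j; simp [coordU, omega_inr_inr hd hz]

theorem coordS_sum_inl (hd : ∀ i, 0 < d i) (hz : IsSpectralData d Mp ν z) (g : Vec n) :
    coordS d ν z (∑ j, g j • eigVec d ν z (Sum.inl j)) = 0 := by
  ext j; simp [coordS, omega_inl_inl hd hz]

theorem coordS_sum_inr (hd : ∀ i, 0 < d i) (hz : IsSpectralData d Mp ν z) (g : Vec n) :
    coordS d ν z (∑ j, g j • eigVec d ν z (Sum.inr j)) = g := by
  ext j
  have h : ∀ i, omega (eigVec d ν z (Sum.inl j)) (eigVec d ν z (Sum.inr i))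
      = -if i = j then 1 else 0 := fun i => by rw [omega_swap, omega_inr_inl hd hz]
  simp [coordS, h]

/-- In the symplectic basis, `omega` becomes the Euclidean pairing of stable with unstable
coordinates. -/
theorem omega_sum_inr (f : Vec n) (y : Phase n) :
    omega (∑ j, f j • eigVec d ν z (Sum.inr j)) y = inner ℝ f (coordU d ν z y) := by
  rw [map_sum, LinearMap.sum_apply, PiLp.inner_apply]
  exact Finset.sum_congr rfl fun j _ => by simp [coordU, mul_comm]

theorem omega_sum_inl (g : Vec n) (y : Phase n) :
    omega (∑ j, g j • eigVec d ν z (Sum.inl j)) y = -inner ℝ g (coordS d ν z y) := by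
  rw [map_sum, LinearMap.sum_apply, PiLp.inner_apply, ← Finset.sum_neg_distrib]
  exact Finset.sum_congr rfl fun j _ => by simp [coordS, mul_comm]

/-- `Vⱼᵘ` and `Vⱼˢ` have the same first component, so their difference lies in the Dirichlet
subspace, which is isotropic. -/
theorem coordU_add_coordS_of_mem_dirichlet {v : Phase n} (hv : v ∈ dirichlet n) :
    coordU d ν z v + coordS d ν z v = 0 := by
  ext j
  have h : omega (eigVec d ν z (Sum.inr j) - eigVec d ν z (Sum.inl j)) v = 0 :=
    omega_of_mem_dirichlet (fun i => by simp [eigVec]) hv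
  rw [map_sub, LinearMap.sub_apply] at h
  simpa [coordU, coordS, sub_eq_add_neg] using h

theorem sum_smul_eq_add (g : Vec n) (w V : Fin n → Phase n) :
    ∑ j, g j • w j = ∑ j, g j • V j + ∑ j, g j • (w j - V j) := by
  rw [← Finset.sum_add_distrib]
  exact Finset.sum_congr rfl fun j _ => by rw [← smul_add, add_sub_cancel]

/-- A family close to the stable eigenvectors that spans an isotropic space spans its own
symplectic complement. -/
theorem exists_eq_sum_of_omega_eq_zero (hn : 1 ≤ n) (hd : ∀ i, 0 < d i)
    (hz : IsSpectralData d Mp ν z) (he : 0 ≤ e) (hX : e * constQ d ν e < 1)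
    {w : Fin n → Phase n} (hw : ∀ j, ‖w j - eigVec d ν z (Sum.inr j)‖ ≤ e)
    (hiso : ∀ i j, omega (w i) (w j) = 0) {y : Phase n} (hy : ∀ j, omega y (w j) = 0) :
    ∃ f : Vec n, y = ∑ j, f j • w j := by
  let Φ : Vec n →ₗ[ℝ] Vec n :=
    { toFun := fun c => coordS d ν z (∑ j, c j • w j)
      map_add' := fun p q => by
        rw [← coordS_add, ← Finset.sum_add_distrib]
        simp [add_smul]
      map_smul' := fun c p => by
        ext j
        simp [coordS, mul_smul, ← Finset.smul_sum] }
  have hΦ : ∀ c, Φ c = coordS d ν z (∑ j, c j • w j) := fun _ => rfl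
  -- `Φ` is the identity plus a map of norm less than one.
  have hinj : Function.Injective Φ := by
    refine (injective_iff_map_eq_zero Φ).2 fun c hc => ?_
    rw [hΦ, sum_smul_eq_add c w fun j => eigVec d ν z (Sum.inr j), coordS_add,
      coordS_sum_inr hd hz] at hc
    have h1 := norm_coordS_sum_le hn hd hz he hw c
    rw [← norm_neg, ← eq_neg_of_add_eq_zero_left hc] at h1
    rw [← norm_eq_zero]
    nlinarith [norm_nonneg c]
  have hsurj : Function.Surjective Φ := LinearMap.injective_iff_surjective.1 hinj
  obtain ⟨f, hf⟩ := hsurj (coordS d ν z y)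
  refine ⟨f, sub_eq_zero.1 ?_⟩
  set y' := y - ∑ j, f j • w j with hy'
  have h1 : coordS d ν z y' = 0 := by
    have : coordS d ν z y' + coordS d ν z (∑ j, f j • w j) = coordS d ν z y := by
      rw [← coordS_add, hy', sub_add_cancel]
    rw [← hΦ, hf] at this
    simpa using this
  have h2 : ∀ j, omega y' (w j) = 0 := fun j => by
    rw [hy', map_sub, LinearMap.sub_apply, hy j, map_sum, LinearMap.sum_apply]
    simp [hiso]
  have h3 : y' = ∑ j, coordU d ν z y' j • eigVec d ν z (Sum.inl j) := by
    have h := eigVec_expansion hd hz y'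
    have h4 : ∑ j, (-omega (eigVec d ν z (Sum.inl j)) y') • eigVec d ν z (Sum.inr j) = 0 :=
      Finset.sum_eq_zero fun j _ => by
        have : -omega (eigVec d ν z (Sum.inl j)) y' = coordS d ν z y' j := rfl
        rw [this, h1]; simp
    rw [h4, add_zero] at h
    exact h
  -- `y'` has only unstable coordinates. Pairing it with the combination of the `w j` whose stable
  -- coordinates equal these gives `-‖coordU d ν z y'‖ ^ 2`, which must vanish.
  obtain ⟨c, hc⟩ := hsurj (coordU d ν z y')
  have h4 : omega y' (∑ j, c j • w j) = 0 := by simp [h2]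
  rw [h3, omega_sum_inl, ← hΦ, hc, real_inner_self_eq_norm_sq, neg_eq_zero] at h4
  have h5 : coordU d ν z y' = 0 := norm_eq_zero.1 (pow_eq_zero_iff two_ne_zero |>.1 h4)
  rw [h3, h5]
  simp

/-- An isotropic combination of families close to the eigenvectors, with small stable part besides
an isotropic correction `f`, does not lie in the Dirichlet subspace unless it is zero. -/
theorem eq_zero_of_mem_dirichlet (hn : 1 ≤ n) (hd : ∀ i, 0 < d i)
    (hz : IsSpectralData d Mp ν z) (he : 0 ≤ e) {b : ℝ} (hb : 0 ≤ b)
    (hsmall : 2 * b + 5 * (e * constQ d ν e) * b + 5 / 2 * (e * constQ d ν e)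
      + 8 * (e * constQ d ν e) ^ 2 < 1)
    {wu ws : Fin n → Phase n} (hwu : ∀ j, ‖wu j - eigVec d ν z (Sum.inl j)‖ ≤ e)
    (hws : ∀ j, ‖ws j - eigVec d ν z (Sum.inr j)‖ ≤ e)
    {f g r : Vec n} (hr : ‖r‖ ≤ b * ‖g‖)
    (hiso : omega (∑ j, f j • ws j) (∑ j, g j • wu j) = 0)
    (hv : ∑ j, g j • wu j + ∑ j, (f + r) j • ws j ∈ dirichlet n) :
    ∑ j, g j • wu j + ∑ j, (f + r) j • ws j = 0 := by
  set X := e * constQ d ν e with hXdef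
  have hQ := constQ_nonneg (d := d) (ν := ν) he
  have hX : 0 ≤ X := mul_nonneg he hQ
  set s := f + r with hs
  -- The Dirichlet condition for the unperturbed eigenvectors would be `g + s = 0`; each family
  -- contributes two coordinate errors of relative size `X`.
  have k1 : ‖g + s‖ ≤ 2 * X * (‖g‖ + ‖s‖) := by
    have h := coordU_add_coordS_of_mem_dirichlet (d := d) (ν := ν) (z := z) hv
    rw [sum_smul_eq_add g wu fun j => eigVec d ν z (Sum.inl j),
      sum_smul_eq_add s ws fun j => eigVec d ν z (Sum.inr j)] at h
    simp only [coordU_add, coordS_add, coordU_sum_inl hd hz, coordU_sum_inr hd hz,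
      coordS_sum_inl hd hz, coordS_sum_inr hd hz] at h
    have a1 := norm_coordU_sum_le hn hd hz he hwu g
    have a2 := norm_coordU_sum_le hn hd hz he hws s
    have a3 := norm_coordS_sum_le hn hd hz he hwu g
    have a4 := norm_coordS_sum_le hn hd hz he hws s
    set p1 := coordU d ν z (∑ j, g j • (wu j - eigVec d ν z (Sum.inl j)))
    set p2 := coordU d ν z (∑ j, s j • (ws j - eigVec d ν z (Sum.inr j)))
    set p3 := coordS d ν z (∑ j, g j • (wu j - eigVec d ν z (Sum.inl j)))
    set p4 := coordS d ν z (∑ j, s j • (ws j - eigVec d ν z (Sum.inr j)))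
    have h' : g + s = -((p1 + p2) + (p3 + p4)) := by
      rw [eq_neg_iff_add_eq_zero, ← h]
      abel
    rw [h', norm_neg]
    have := norm_add_le (p1 + p2) (p3 + p4)
    have := norm_add_le p1 p2
    have := norm_add_le p3 p4
    linarith
  -- Expanding `hiso` gives `⟪f, g⟫` plus two errors linear in the perturbations, each with constant
  -- `X`, and one quadratic error with constant `X / 2`. The last one uses the summand `2 * e * n`
  -- of `C_Q`.
  have k2 : |inner ℝ f g| ≤ 5 / 2 * X * (‖f‖ * ‖g‖) := by
    set D1 := ∑ j, f j • (ws j - eigVec d ν z (Sum.inr j)) with hD1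
    set D2 := ∑ j, g j • (wu j - eigVec d ν z (Sum.inl j)) with hD2
    have a1 : |omega D1 D2| ≤ X / 2 * (‖f‖ * ‖g‖) := by
      have hn2 : √(n : ℝ) * √n = n := Real.mul_self_sqrt (by positivity)
      have hQ' : 2 * e * n ≤ constQ d ν e := by
        have := sigma_nonneg (d := d) (ν := ν)
        have := Real.sqrt_nonneg (2 * n / ((⨅ j, ν j) * ⨅ i, d i))
        unfold constQ
        linarith
      calc _ ≤ ‖D1‖ * ‖D2‖ := abs_omega_le _ _
        _ ≤ (e * (√n * ‖f‖)) * (e * (√n * ‖g‖)) := by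
            gcongr
            · exact norm_sum_smul_le hws f
            · exact norm_sum_smul_le hwu g
        _ = e * (2 * e * (√n * √n)) / 2 * (‖f‖ * ‖g‖) := by ring
        _ ≤ _ := by
            rw [hn2, hXdef]
            gcongr
    have a2 : |inner ℝ f (coordU d ν z D2)| ≤ X * (‖f‖ * ‖g‖) := by
      refine (abs_real_inner_le_norm _ _).trans ?_
      calc _ ≤ ‖f‖ * (X * ‖g‖) := by gcongr; exact norm_coordU_sum_le hn hd hz he hwu g
        _ = _ := by ring
    have a3 : |inner ℝ g (coordS d ν z D1)| ≤ X * (‖f‖ * ‖g‖) := by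
      refine (abs_real_inner_le_norm _ _).trans ?_
      calc _ ≤ ‖g‖ * (X * ‖f‖) := by gcongr; exact norm_coordS_sum_le hn hd hz he hws f
        _ = _ := by ring
    rw [sum_smul_eq_add f ws fun j => eigVec d ν z (Sum.inr j), map_add, LinearMap.add_apply,
      omega_sum_inr, sum_smul_eq_add g wu fun j => eigVec d ν z (Sum.inl j), coordU_add,
      coordU_sum_inl hd hz, inner_add_right, map_add, ← hD1, ← hD2,
      omega_swap _ D1, omega_sum_inl, neg_neg] at hiso
    rw [abs_le] at a1 a2 a3 ⊢
    constructor <;> linarith [a1.1, a1.2, a2.1, a2.2, a3.1, a3.2]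
  have k3 : |inner ℝ r g| ≤ b * ‖g‖ ^ 2 := by
    refine (abs_real_inner_le_norm _ _).trans ?_
    nlinarith [norm_nonneg g]
  have k4 : ‖f‖ ≤ ‖s‖ + b * ‖g‖ := by
    have : f = s - r := by rw [hs, add_sub_cancel_right]
    rw [this]
    exact (norm_sub_le _ _).trans (by gcongr)
  have k5 : ‖g + s‖ ^ 2 = ‖g‖ ^ 2 + 2 * (inner ℝ f g + inner ℝ r g) + ‖s‖ ^ 2 := by
    rw [norm_add_sq_real, ← inner_add_left, ← hs, real_inner_comm]
  have k6 : ‖g + s‖ ^ 2 ≤ 8 * X ^ 2 * (‖g‖ ^ 2 + ‖s‖ ^ 2) := by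
    calc _ ≤ (2 * X * (‖g‖ + ‖s‖)) ^ 2 := by gcongr
      _ = 8 * X ^ 2 * (‖g‖ ^ 2 + ‖s‖ ^ 2) - 4 * X ^ 2 * (‖g‖ - ‖s‖) ^ 2 := by ring
      _ ≤ _ := by have : 0 ≤ 4 * X ^ 2 * (‖g‖ - ‖s‖) ^ 2 := by positivity
                  linarith
  set G := ‖g‖
  set S := ‖s‖
  have hG : 0 ≤ G := norm_nonneg g
  have hS : 0 ≤ S := norm_nonneg s
  have k7 : 5 / 2 * X * (‖f‖ * G) ≤ 5 / 4 * X * (G ^ 2 + S ^ 2) + 5 / 2 * X * b * G ^ 2 := by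
    calc _ ≤ 5 / 2 * X * ((S + b * G) * G) := by gcongr
      _ = 5 / 4 * X * (G ^ 2 + S ^ 2) + 5 / 2 * X * b * G ^ 2 - 5 / 4 * X * (G - S) ^ 2 := by ring
      _ ≤ _ := by have : 0 ≤ 5 / 4 * X * (G - S) ^ 2 := by positivity
                  linarith
  -- Equating the expansion `k5` with the upper bound `k6`, after estimating both inner products.
  have k8 : (1 - (2 * b + 5 * X * b + 5 / 2 * X + 8 * X ^ 2)) * (G ^ 2 + S ^ 2) ≤ 0 := by
    have h1 := (abs_le.1 k2).1
    have h2 := (abs_le.1 k3).1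
    have h3 : 0 ≤ (2 * b + 5 * X * b) * S ^ 2 := by positivity
    nlinarith
  have k9 : G ^ 2 + S ^ 2 ≤ 0 := by
    by_contra hcon
    push Not at hcon
    nlinarith
  have hG0 : g = 0 := norm_eq_zero.1 (pow_eq_zero_iff two_ne_zero |>.1
    (le_antisymm (by nlinarith [sq_nonneg S]) (sq_nonneg G)))
  have hS0 : s = 0 := norm_eq_zero.1 (pow_eq_zero_iff two_ne_zero |>.1
    (le_antisymm (by nlinarith [sq_nonneg G]) (sq_nonneg S)))
  rw [hG0, hS0]
  simp

/-- With `X = e C_Q` and `Y = e C_P`, the explicit bound dominates `4X + 9X² + 4b + 9b²`, and this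
being less than one is already sufficient. -/
theorem LargeEnough.small {lam b : ℝ} (he : 0 ≤ e) (hb : 0 ≤ b) (h : LargeEnough d ν lam e b) :
    2 * b + 5 * (e * constQ d ν e) * b + 5 / 2 * (e * constQ d ν e)
      + 8 * (e * constQ d ν e) ^ 2 < 1 := by
  have hP : 0 ≤ constP d ν e := by
    have := sigma_nonneg (d := d) (ν := ν)
    have : 0 < 1 - e * sigma d ν := by linarith [h.sigma_lt]
    unfold constP
    positivity
  have hX : 0 ≤ e * constQ d ν e := mul_nonneg he (constQ_nonneg he)
  have hY : 0 ≤ e * constP d ν e := mul_nonneg he hP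
  have h1 : e * constQ d ν e * (2 + e * constQ d ν e) < 1 := h.constM1_lt
  have h2 : e * constP d ν e * (2 + e * constP d ν e) + 2 * b * (1 + e * constP d ν e) + b ^ 2 < 1 :=
    h.constM2_lt
  have hbd := h.bound_lt
  rw [projectionBound, constM1, constM2] at hbd
  set X := e * constQ d ν e
  set Y := e * constP d ν e
  -- The first two terms of the geometric series for `a / (1 - a)`, followed by monotonicity.
  have hfrac : ∀ a c : ℝ, 0 ≤ a → a ≤ c → c < 1 → a + a ^ 2 ≤ c / (1 - c) := by
    intro a c ha hac hc
    rw [le_div_iff₀ (by linarith)]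
    nlinarith [mul_nonneg ha ha, pow_nonneg (ha.trans hac) 3, mul_self_le_mul_self ha hac]
  have f1 := hfrac (2 * X) _ (by positivity) (by nlinarith) h1
  have f2 := hfrac (2 * b) _ (by positivity) (by nlinarith [mul_nonneg hb hY]) h2
  have g1 : 2 * X + 8 * X ^ 2 ≤ (1 + X) ^ 2 * (X * (2 + X) / (1 - X * (2 + X))) := by
    calc _ ≤ (1 + X) ^ 2 * (2 * X + (2 * X) ^ 2) := by
          have : 0 ≤ X ^ 3 := by positivity
          have : 0 ≤ X ^ 4 := by positivity
          nlinarith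
      _ ≤ _ := by gcongr
  have g2 : 2 * b + 8 * b ^ 2 ≤ (1 + Y + b) ^ 2 * ((Y * (2 + Y) + 2 * b * (1 + Y) + b ^ 2)
      / (1 - (Y * (2 + Y) + 2 * b * (1 + Y) + b ^ 2))) := by
    calc _ ≤ (1 + b) ^ 2 * (2 * b + (2 * b) ^ 2) := by
          have : 0 ≤ b ^ 3 := by positivity
          have : 0 ≤ b ^ 4 := by positivity
          nlinarith
      _ ≤ _ := by gcongr; linarith
  have g3 : 2 * e * (constQ d ν e + constP d ν e) = 2 * X + 2 * Y := by ring
  have g4 : e ^ 2 * (constQ d ν e ^ 2 + constP d ν e ^ 2) = X ^ 2 + Y ^ 2 := by ring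
  rw [g3, g4] at hbd
  have hbY : 0 ≤ b * Y := mul_nonneg hb hY
  have g5 : 4 * X + 9 * X ^ 2 + 4 * b + 9 * b ^ 2 < 1 := by nlinarith [sq_nonneg Y]
  -- `5Xb ≤ 5/2 (X² + b²)`; the excess in `X²` is absorbed by the linear term because `4X < 1`.
  nlinarith [sq_nonneg (X - b), sq_nonneg X, sq_nonneg b]

end pointwise

/-! ### Pairings and coefficients of the asymptotic solutions -/

section asymptotics
variable {n : ℕ} {d : Fin n → ℝ} {M : ℝ → Matrix (Fin n) (Fin n) ℝ}
  {Mm Mp : Matrix (Fin n) (Fin n) ℝ} {CM ηM : ℝ} {ν : Fin n → ℝ} {z : Fin n → Vec n}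
  {K L : ℝ} {W : Fin n ⊕ Fin n → ℝ → Phase n} {Uφ : ℝ → Phase n} {U : Fin (n - 1) → ℝ → Phase n}
  {Γt Bt : Matrix (Fin n) (Fin (n - 1)) ℝ}

theorem IsAsymptoticFamily.tendsto_inr (hz : IsSpectralData d Mp ν z)
    (hW : IsAsymptoticFamily d M Mp ν z L W) (j : Fin n) :
    Tendsto (fun x => Real.exp (-ν j * x) • W (Sum.inr j) x) atTop (𝓝 0) := by
  obtain ⟨-, ⟨C, hC⟩, -⟩ := hW (Sum.inr j)
  have h1 : Tendsto (fun x => Real.exp (-ν j * x) * C) atTop (𝓝 0) := by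
    have : Tendsto (fun x => -ν j * x) atTop atBot :=
      tendsto_id.const_mul_atTop_of_neg (by linarith [hz.ν_pos j])
    simpa using (Real.tendsto_exp_atBot.comp this).mul_const C
  refine squeeze_zero_norm' ?_ h1
  filter_upwards [eventually_ge_atTop L] with x hx
  rw [norm_smul, Real.norm_eq_abs, Real.abs_exp]
  gcongr
  exact hC x hx

theorem IsAsymptoticFamily.continuousOn (hW : IsAsymptoticFamily d M Mp ν z L W)
    (i : Fin n ⊕ Fin n) : ContinuousOn (fun x => Real.exp (rate ν i * x) • W i x) (Ici L) :=
  have h : Continuous fun x => Real.exp (rate ν i * x) := by fun_prop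
  h.continuousOn.smul (hW i).1

/-- The weighted functions `e^{-νⱼ x} Wⱼˢ` are decaying solutions, so their pairing vanishes; the
nonzero weights are then divided out. -/
theorem omega_asymptotic_inr_inr (hH : Hyp d M Mm Mp CM ηM) (hz : IsSpectralData d Mp ν z)
    (hK : IsDichotomyConst d Mp ν z K) (hL : 0 ≤ L) (hW : IsAsymptoticFamily d M Mp ν z L W)
    (i j : Fin n) {x : ℝ} (hx : L ≤ x) : omega (W (Sum.inr i) x) (W (Sum.inr j) x) = 0 := by
  have h := eq_zero_of_deriv_eq_zero_of_tendsto
    (continuousOn_omega (hW.continuousOn (Sum.inr i)) (hW.continuousOn (Sum.inr j)))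
    (fun y hy => hasDerivAt_omega (hH.symm y)
      (hasDerivAt_exp_smul_asymptotic hH hz hK hL hW (Sum.inr i) hy)
      (hasDerivAt_exp_smul_asymptotic hH hz hK hL hW (Sum.inr j) hy))
    (tendsto_omega (hW.tendsto_inr hz i) (hW.tendsto_inr hz j)) hx
  simpa [Real.exp_ne_zero] using h

theorem IsSolution.omega_asymptotic_inr (hH : Hyp d M Mm Mp CM ηM) (hz : IsSpectralData d Mp ν z)
    (hK : IsDichotomyConst d Mp ν z K) (hL : 0 ≤ L) (hW : IsAsymptoticFamily d M Mp ν z L W)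
    {V : ℝ → Phase n} (hV : IsSolution d M V) (tV : Tendsto V atTop (𝓝 0))
    (j : Fin n) {x : ℝ} (hx : L ≤ x) : omega (V x) (W (Sum.inr j) x) = 0 := by
  have h := eq_zero_of_deriv_eq_zero_of_tendsto
    (continuousOn_omega hV.continuous.continuousOn (hW.continuousOn (Sum.inr j)))
    (fun y hy => hasDerivAt_omega (hH.symm y) (hV y)
      (hasDerivAt_exp_smul_asymptotic hH hz hK hL hW (Sum.inr j) hy))
    (tendsto_omega tV (hW.tendsto_inr hz j)) hx
  simpa [Real.exp_ne_zero] using h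

/-- The weighted coefficient vector `(∑ₖ Aⱼₖ e^{κⱼ x} cₖ)ⱼ`. -/
def weighted (κ : Fin n → ℝ) (A : Matrix (Fin n) (Fin (n - 1)) ℝ) (c : Fin (n - 1) → ℝ) (x : ℝ) :
    Vec n :=
  WithLp.toLp 2 fun j => Real.exp (κ j * x) * A.mulVec c j

theorem IsCoeff.sum_eq (hc : IsCoeff ν L W U Γt Bt) (c : Fin (n - 1) → ℝ) {x : ℝ} (hx : L ≤ x) :
    ∑ k, c k • U k x = ∑ j, weighted ν Γt c x j • W (Sum.inl j) x
      + ∑ j, weighted (fun j => -ν j) Bt c x j • W (Sum.inr j) x := by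
  rw [Finset.sum_congr rfl fun k _ => by rw [hc k x hx, Finset.smul_sum], Finset.sum_comm,
    ← Finset.sum_add_distrib]
  refine Finset.sum_congr rfl fun j _ => ?_
  simp only [smul_add, Finset.sum_add_distrib, smul_smul, ← Finset.sum_smul, weighted,
    Matrix.mulVec, dotProduct, Finset.mul_sum]
  congr 2 <;> exact Finset.sum_congr rfl fun k _ => by ring

/-- The coefficient matrix of the growing part has full column rank. -/
theorem IsCoeff.injective (hH : Hyp d M Mm Mp CM ηM) (hz : IsSpectralData d Mp ν z)
    (hW : IsAsymptoticFamily d M Mp ν z L W) (hU : IsFrame d M Uφ U)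
    (hc : IsCoeff ν L W U Γt Bt) : Function.Injective Γt.mulVec := by
  refine (injective_iff_map_eq_zero Γt.mulVecLin).2 fun c h => ?_
  refine hU.eq_zero_of_tendsto hH c ?_
  -- If `Γt` annihilates `c`, only the stable part of `∑ k, c k • U k` is left, and it decays.
  have h1 : Tendsto (fun x => ∑ j, Bt.mulVec c j • Real.exp (-ν j * x) • W (Sum.inr j) x) atTop
      (𝓝 0) := by
    simpa using tendsto_finsetSum Finset.univ fun j _ =>
      (hW.tendsto_inr hz j).const_smul (Bt.mulVec c j)
  refine h1.congr' ?_
  filter_upwards [eventually_ge_atTop L] with x hx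
  have h' : Γt.mulVec c = 0 := h
  rw [hc.sum_eq c hx]
  simp only [weighted, h', smul_smul]
  simp [mul_comm]

theorem epsB_nonneg : 0 ≤ epsB ν L Γt Bt := by
  unfold epsB
  positivity

/-- The left vector is at most `e^{-ν_min x} ‖Bt‖ ‖c‖` and the right one at least `e^{ν_min x} √μ*
‖c‖`. The quotient of these bounds is largest at `x = L`, where it equals `ε_b`. -/
theorem norm_weighted_le (hz : IsSpectralData d Mp ν z) (hL : 0 ≤ L)
    (hinj : Function.Injective Γt.mulVec) (c : Fin (n - 1) → ℝ) {x : ℝ} (hx : L ≤ x) :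
    ‖weighted (fun j => -ν j) Bt c x‖ ≤ epsB ν L Γt Bt * ‖weighted ν Γt c x‖ := by
  rcases isEmpty_or_nonempty (Fin (n - 1)) with _ | _
  -- Without columns the left side is zero, so the value of `muStar` is irrelevant.
  · have h1 : weighted (fun j => -ν j) Bt c x = 0 := by
      ext j; simp [weighted, Matrix.mulVec, dotProduct]
    rw [h1, norm_zero]
    exact mul_nonneg epsB_nonneg (norm_nonneg _)
  have hpd : (Γt.transpose * Γt).PosDef := by
    have := Matrix.PosDef.conjTranspose_mul_self Γt hinj
    rwa [Matrix.conjTranspose_eq_transpose_of_trivial] at this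
  obtain ⟨hμ, hμ'⟩ := sInf_spectrum_pos hpd
  change 0 < muStar Γt at hμ
  set νm := ⨅ j, ν j
  have h1 : ∀ j, νm ≤ ν j := fun j => ciInf_le (Set.finite_range _).bddBelow j
  have hνm : 0 ≤ νm := Real.iInf_nonneg fun j => (hz.ν_pos j).le
  have hx0 : 0 ≤ x := hL.trans hx
  set cv : EuclideanSpace ℝ (Fin (n - 1)) := WithLp.toLp 2 c
  have b1 : ‖weighted (fun j => -ν j) Bt c x‖ ≤ Real.exp (-νm * x) * (‖Bt‖ * ‖cv‖) := by
    have : ‖weighted (fun j => -ν j) Bt c x‖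
        ≤ Real.exp (-νm * x) * ‖Matrix.toEuclideanLin Bt cv‖ := by
      refine le_of_sq_le_sq ?_ (by positivity)
      rw [mul_pow, EuclideanSpace.real_norm_sq_eq, EuclideanSpace.real_norm_sq_eq, Finset.mul_sum]
      refine Finset.sum_le_sum fun j _ => ?_
      have e1 : weighted (fun j => -ν j) Bt c x j = Real.exp (-ν j * x) * Bt.mulVec c j := rfl
      have e2 : Matrix.toEuclideanLin Bt cv j = Bt.mulVec c j := rfl
      rw [e1, e2, mul_pow]
      have := h1 j
      gcongr
    exact this.trans (by gcongr; exact Matrix.l2_opNorm_mulVec Bt cv)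
  have b2 : Real.exp (νm * x) * (√(muStar Γt) * ‖cv‖) ≤ ‖weighted ν Γt c x‖ := by
    have a1 : √(muStar Γt) * ‖cv‖ ≤ ‖Matrix.toEuclideanLin Γt cv‖ := by
      refine le_of_sq_le_sq ?_ (by positivity)
      rw [mul_pow, Real.sq_sqrt hμ.le, EuclideanSpace.real_norm_sq_eq,
        EuclideanSpace.real_norm_sq_eq]
      have := mul_dotProduct_le_of_le_spectrum hpd.isHermitian hμ' c
      rw [← Matrix.mulVec_mulVec, Matrix.dotProduct_mulVec, Matrix.vecMul_transpose] at this
      simp only [dotProduct, ← pow_two] at this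
      exact this
    have a2 : Real.exp (νm * x) * ‖Matrix.toEuclideanLin Γt cv‖ ≤ ‖weighted ν Γt c x‖ := by
      refine le_of_sq_le_sq ?_ (by positivity)
      rw [mul_pow, EuclideanSpace.real_norm_sq_eq, EuclideanSpace.real_norm_sq_eq, Finset.mul_sum]
      refine Finset.sum_le_sum fun j _ => ?_
      have e1 : weighted ν Γt c x j = Real.exp (ν j * x) * Γt.mulVec c j := rfl
      have e2 : Matrix.toEuclideanLin Γt cv j = Γt.mulVec c j := rfl
      rw [e1, e2, mul_pow]
      have := h1 j
      gcongr
    exact le_trans (by gcongr) a2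
  have hs : 0 < √(muStar Γt) := Real.sqrt_pos.2 hμ
  have b3 : Real.exp (-νm * x) ≤ Real.exp (-2 * νm * L) * Real.exp (νm * x) := by
    rw [← Real.exp_add]
    gcongr
    nlinarith
  calc _ ≤ Real.exp (-νm * x) * (‖Bt‖ * ‖cv‖) := b1
    _ ≤ Real.exp (-2 * νm * L) * Real.exp (νm * x) * (‖Bt‖ * ‖cv‖) := by gcongr
    _ = 1 / √(muStar Γt) * Real.exp (-2 * νm * L) * ‖Bt‖ * (Real.exp (νm * x) * (√(muStar Γt) * ‖cv‖)) := by
        field_simp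
    _ ≤ _ := by
        change epsB ν L Γt Bt * _ ≤ _
        gcongr
        exact epsB_nonneg

end asymptotics
end ConjPt
end

/-! ### Absence of conjugate points -/

open ConjPt
theorem theorem2p1 {n : ℕ} (hn : 1 ≤ n)
    (d : Fin n → ℝ) (M : ℝ → Matrix (Fin n) (Fin n) ℝ) (Mm Mp : Matrix (Fin n) (Fin n) ℝ)
    (CM ηM : ℝ) (hH : Hyp d M Mm Mp CM ηM)
    (ν : Fin n → ℝ) (z : Fin n → Vec n) (hz : IsSpectralData d Mp ν z)
    (K : ℝ) (hK : IsDichotomyConst d Mp ν z K)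
    (L : ℝ) (hL : 0 ≤ L)
    (W : Fin n ⊕ Fin n → ℝ → Phase n) (hW : IsAsymptoticFamily d M Mp ν z L W)
    (Uφ : ℝ → Phase n) (U : Fin (n - 1) → ℝ → Phase n) (hU : IsFrame d M Uφ U)
    (Γt Bt : Matrix (Fin n) (Fin (n - 1)) ℝ) (hc : IsCoeff ν L W U Γt Bt)
    (hlarge : LargeEnough d ν (contractionConst K CM ηM L)
      (eps0 d ν z (contractionConst K CM ηM L)) (epsB ν L Γt Bt)) :
    (∀ x ≥ L, unstableSubspace d M x ⊓ dirichlet n = ⊥) ∧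
      ∀ s ∈ Set.Ici L, ¬ IsConjugatePoint d M s := by
  suffices h : ∀ x ≥ L, unstableSubspace d M x ⊓ dirichlet n = ⊥ from
    ⟨h, fun s hs hconj => hconj (h s hs)⟩
  intro x hx
  set e := eps0 d ν z (contractionConst K CM ηM L)
  have he : 0 ≤ e := eps0_nonneg (contractionConst_nonneg hH hK.1) hlarge.lam_lt
  have hb : 0 ≤ epsB ν L Γt Bt := epsB_nonneg
  have hsmall := hlarge.small he hb
  have hclose := fun i => norm_sub_eigVec_le hH hK hL hW hlarge.lam_lt i hx
  have hX : 0 ≤ e * constQ d ν e := mul_nonneg he (constQ_nonneg he)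
  have hiso := fun i j => omega_asymptotic_inr_inr hH hz hK hL hW i j hx
  -- `Uφ x` is orthogonal to the Lagrangian span of the stable family, hence lies in it; the
  -- required `X < 1` follows from `hsmall`.
  obtain ⟨f, hf⟩ := exists_eq_sum_of_omega_eq_zero hn hH.d_pos hz he
    (by nlinarith [mul_nonneg hX hb]) (fun j => hclose (Sum.inr j)) hiso
    (fun j => hU.sol_φ.omega_asymptotic_inr hH hz hK hL hW hU.decay_φ j hx)
  rw [Submodule.eq_bot_iff]
  rintro v ⟨hv, hvD⟩
  obtain ⟨t, c, rfl⟩ := hU.exists_coeff hv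
  set g := weighted ν Γt c x
  set r := weighted (fun j => -ν j) Bt c x
  have hv' : t • Uφ x + ∑ k, c k • U k x = ∑ j, g j • W (Sum.inl j) x
      + ∑ j, (t • f + r) j • W (Sum.inr j) x := by
    rw [hc.sum_eq c hx, hf, Finset.smul_sum]
    simp only [PiLp.add_apply, PiLp.smul_apply, smul_eq_mul, add_smul, Finset.sum_add_distrib,
      mul_smul]
    abel
  have htf : ∑ j, (t • f) j • W (Sum.inr j) x = t • Uφ x := by
    rw [hf, Finset.smul_sum]
    exact Finset.sum_congr rfl fun j _ => by simp [mul_smul]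
  -- Decay at `-∞` kills the pairing of `Uφ` with the `U k`, decay at `+∞` that with the stable part
  -- of their expansion; so the pairing with the unstable part vanishes too.
  have hisoφ : omega (∑ j, (t • f) j • W (Sum.inr j) x) (∑ j, g j • W (Sum.inl j) x) = 0 := by
    have h1 : omega (Uφ x) (∑ k, c k • U k x) = 0 := by
      rw [map_sum]
      refine Finset.sum_eq_zero fun k _ => ?_
      rw [map_smul, hU.sol_φ.omega_eq_zero hH.symm (hU.sol k) (hU.tendsto_atBot_φ hH)
        (hU.tendsto_atBot hH k), smul_zero]
    have h2 : omega (Uφ x) (∑ j, r j • W (Sum.inr j) x) = 0 := by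
      rw [map_sum]
      refine Finset.sum_eq_zero fun j _ => ?_
      rw [map_smul, hU.sol_φ.omega_asymptotic_inr hH hz hK hL hW hU.decay_φ j hx, smul_zero]
    rw [hc.sum_eq c hx, map_add, h2, add_zero] at h1
    rw [htf, map_smul, LinearMap.smul_apply, h1, smul_zero]
  rw [hv'] at hvD ⊢
  exact eq_zero_of_mem_dirichlet hn hH.d_pos hz he hb hsmall (fun j => hclose (Sum.inl j))
    (fun j => hclose (Sum.inr j)) (norm_weighted_le hz hL (hc.injective hH hz hW hU) c hx)
    hisoφ hvD
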